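/- Let $n:\mathbb N\to\mathbb N$ be a message length, as a function of the security parameter $\lambda$ (write $n=n(\lambda)$). A function of $\lambda$ is negligible if it decays faster than every inverse polynomial. A quantum polynomial-time (QPT) algorithm is a family, indexed by $\lambda$, of polynomial-size (non-uniform) quantum circuits over a fixed universal gate set, with ancillas $|0\rangle$ and discarding of wires. **Conjugate encryption** $\mathsf{UE}$ (Broadbent–Lord): the key is a uniformly random pair $(\theta,r)\in\{0,1\}^n\times\{0,1\}^n$; a message $m\in\{0,1\}^n$ is encrypted as the $n$-qubit state $H^{\theta}|m\oplus r\rangle$, where $H^\theta=H^{\theta_1}\otimes\dots\otimes H^{\theta_n}$ and $H$ is the Hadamard gate; decryption measures in the basis $\{H^\theta|x\rangle\}_x$ and outputs $x\oplus r$. **Fake-key property.** Let $\mathsf{PKE}=(\mathsf{Setup},\mathsf{Enc},\mathsf{Dec})$ be a classical randomized private-key encryption scheme with message space $\{0,1\}^{2n}$ and with keys and ciphertexts that are bit strings. It has the fake-key property if there is a randomized algorithm $\mathit{FakeGen}$ such that for every QPT distinguisher $D$ there is a negligible $\varepsilon$ such that, for all $\lambda$ and all messages $\mu$, the probabilities that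 $D$ accepts $(\mathsf{Enc}(k,\mu),k)$ and $(ct^0,\mathit{FakeGen}(ct^0,\mu))$, where $k\leftarrow\mathsf{Setup}(1^\lambda)$ and $ct^0\leftarrow\mathsf{Enc}(k,0)$, differ by at most $\varepsilon(\lambda)$. (No bound on the running times of $\mathsf{PKE}$ or $\mathit{FakeGen}$ is needed below.) **The reusable scheme.** Setup outputs $k\leftarrow\mathsf{PKE}.\mathsf{Setup}(1^\lambda)$. To encrypt $m\in\{0,1\}^n$ under $k$, sample a fresh key $k_{UE}$ of $\mathsf{UE}$ and output $(\mathsf{PKE}.\mathsf{Enc}(k,k_{UE}),\ \mathsf{UE}.\mathsf{Enc}(k_{UE},m))$. To decrypt, recover $k_{UE}$ with $\mathsf{PKE}.\mathsf{Dec}(k,\cdot)$ and apply $\mathsf{UE}.\mathsf{Dec}(k_{UE},\cdot)$. **Cloning experiment.** A key $k$ and a uniformly random $m\in\{0,1\}^n$ are sampled. Alice receives the encryption of $m$ under $k$ and maps it to a bipartite state $\rho_{BC}$. Bob receives $k$ and register $B$, Charlie receives $k$ and register $C$; without communicating, each outputs a guess of $m$. The adversary succeeds if both guesses equal $m$. A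 scheme is $t$-uncloneable secure if every QPT adversary (Alice, Bob, Charlie) succeeds with probability at most $2^{-n+t}+\varepsilon(\lambda)$ for some negligible $\varepsilon$. **Corollary.** If $\mathsf{PKE}$ has the fake-key property, then the reusable scheme built from $\mathsf{PKE}$ and conjugate encryption is $t$-uncloneable secure with $t=n\log_2\!\left(1+\tfrac1{\sqrt2}\right)$. Equivalently, every QPT cloning adversary succeeds with probability at most $\left(\tfrac12+\tfrac1{2\sqrt2}\right)^{n}+\varepsilon(\lambda)$ for some negligible $\varepsilon$. -/

import Mathlib

open scoped ComplexOrder Kronecker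

noncomputable section

namespace UncloneableEncryption

/-! ### Bit registers, tensor products, asymptotics -/

/-- Bit strings with positions in `W`. They label the computational basis of the register of
qubits (wires) `W`, so an operator on that register is a `Matrix (Bits W) (Bits W) ℂ`. -/
abbrev Bits (W : Type) : Type := W → Bool

/-- Operators on the register `W`. -/
abbrev Op (W : Type) : Type := Matrix (Bits W) (Bits W) ℂ

/-- Tensor product of operators on the registers `V` and `W`, an operator on `V ⊕ W`. -/
def tensor {V W : Type} (A : Op V) (B : Op W) : Op (V ⊕ W) :=
  (A ⊗ₖ B).submatrix (Equiv.sumArrowEquivProdArrow V W Bool)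
    (Equiv.sumArrowEquivProdArrow V W Bool)

/-- The diagonal density operator of a classical distribution. -/
def classicalState {W : Type} [Fintype W] [DecidableEq W] (p : PMF (Bits W)) : Op W :=
  Matrix.diagonal fun x => ((p x).toReal : ℂ)

/-- `ε(l)` tends to zero faster than every inverse polynomial in `l`. -/
def Negligible (ε : ℕ → ℝ) : Prop :=
  Asymptotics.SuperpolynomialDecay Filter.atTop (fun l : ℕ => (l : ℝ)) ε

/-- `f` is bounded by a polynomial. -/
def PolyBounded (f : ℕ → ℕ) : Prop :=
  ∃ p : Polynomial ℕ, ∀ l, f l ≤ p.eval l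

/-! ### Quantum circuits -/

/-- A universal gate set; the constructors name the wires on which a gate acts (for `cnot` and
`toffoli` the last wire is the target). -/
inductive Gate (W : Type) : Type
  | x (i : W) : Gate W
  | h (i : W) : Gate W
  | t (i : W) : Gate W
  | cnot (i j : W) (hij : i ≠ j) : Gate W
  | toffoli (i j k : W) (hij : i ≠ j) (hik : i ≠ k) (hjk : j ≠ k) : Gate W

/-- The entry `⟨y| H |x⟩` of the Hadamard gate. -/
def hadamard (y x : Bool) : ℂ :=
  (1 / (Real.sqrt 2 : ℂ)) * (if y && x then -1 else 1)

/-- The unitary of a gate on the register `W`; the entry at `(y, z)` is `⟨y| U |z⟩`. -/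
def Gate.unitary {W : Type} [Fintype W] [DecidableEq W] : Gate W → Op W
  | .x i => Matrix.of fun y z => if y = Function.update z i (!z i) then 1 else 0
  | .h i => Matrix.of fun y z => if ∀ j, j ≠ i → y j = z j then hadamard (y i) (z i) else 0
  | .t i => Matrix.diagonal fun z =>
      if z i then Complex.exp (Complex.I * (Real.pi / 4 : ℝ)) else 1
  | .cnot i j _ => Matrix.of fun y z => if y = Function.update z j (xor (z j) (z i)) then 1 else 0
  | .toffoli i j k _ _ _ => Matrix.of fun y z =>
      if y = Function.update z k (xor (z k) (z i && z j)) then 1 else 0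

/-- The unitary of a list of gates, the head of the list being applied first. -/
def gatesUnitary {W : Type} [Fintype W] [DecidableEq W] : List (Gate W) → Op W
  | [] => 1
  | g :: gs => gatesUnitary gs * g.unitary

/-- A quantum circuit with input register `I` and output register `O`: ancillas in state `|0⟩` are
added, gates are applied, the wires in the range of `out` are the output and all the others are
discarded. -/
structure QCircuit (I O : Type) where
  anc : ℕ
  gates : List (Gate (I ⊕ Fin anc))
  out : O ↪ I ⊕ Fin anc

namespace QCircuit

variable {I O K R : Type} [Fintype I] [DecidableEq I] [Fintype O] [DecidableEq O]
  [Fintype K] [DecidableEq K] [Fintype R] [DecidableEq R]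

/-- Number of wires plus number of gates. -/
def size (c : QCircuit I O) : ℕ := Fintype.card I + c.anc + c.gates.length

/-- The isometry from the input register to all wires: `|x⟩ ↦ U (|x⟩ ⊗ |0…0⟩)`. -/
def isometry (c : QCircuit I O) : Matrix (Bits (I ⊕ Fin c.anc)) (Bits I) ℂ :=
  Matrix.of fun y x => gatesUnitary c.gates y (Sum.elim x fun _ => false)

/-- The channel computed by the circuit: apply the isometry, then trace out all wires that are not
output wires. -/
def channel (c : QCircuit I O) (ρ : Op I) : Op O :=
  Matrix.of fun o o' => ∑ y, ∑ y',
    if (∀ j, y (c.out j) = o j) ∧ (∀ j, y' (c.out j) = o' j) ∧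
        ∀ w, (∀ j, c.out j ≠ w) → y w = y' w
    then (c.isometry * ρ * c.isometry.conjTranspose) y y' else 0

/-- The probability that measuring the output register in the computational basis, after running
the circuit on the basis state `|x⟩`, gives `o`. -/
def prob (c : QCircuit I O) (x : Bits I) (o : Bits O) : ℝ :=
  ∑ y, if ∀ j, y (c.out j) = o j then ‖c.isometry y x‖ ^ 2 else 0

/-- For a circuit that gets a classical string `k` and a quantum register `R`: the POVM element on
`R` of the event that measuring the output register gives `o`. -/
def effect (c : QCircuit (K ⊕ R) O) (k : Bits K) (o : Bits O) : Op R :=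
  let V : Matrix (Bits ((K ⊕ R) ⊕ Fin c.anc)) (Bits R) ℂ :=
    Matrix.of fun y s => c.isometry y (Sum.elim k s)
  V.conjTranspose * Matrix.diagonal (fun y : Bits ((K ⊕ R) ⊕ Fin c.anc) =>
    if ∀ j, y (c.out j) = o j then (1 : ℂ) else 0) * V

end QCircuit

/-! ### Classical private-key encryption and the fake-key property -/

/-- A classical private-key encryption scheme, given by its randomized algorithms, with keys,
messages and ciphertexts in `Bits (K l)`, `Bits (M l)`, `Bits (C l)` for security parameter `l`. -/
structure PrivKeyEnc (K M C : ℕ → Type) where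
  setup : ∀ l, PMF (Bits (K l))
  enc : ∀ l, Bits (K l) → Bits (M l) → PMF (Bits (C l))
  dec : ∀ l, Bits (K l) → Bits (C l) → PMF (Bits (M l))

namespace PrivKeyEnc

variable {K M C : ℕ → Type}

/-- The distribution of `(Enc(k, m), k)` for `k ← Setup`. -/
def realDist (E : PrivKeyEnc K M C) (l : ℕ) (m : Bits (M l)) : PMF (Bits (C l ⊕ K l)) :=
  (E.setup l).bind fun k => (E.enc l k m).bind fun ct => PMF.pure (Sum.elim ct k)

/-- The distribution of `(ct⁰, FakeGen(ct⁰, m))` for `k ← Setup`, `ct⁰ ← Enc(k, 0)`. -/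
def fakeDist (E : PrivKeyEnc K M C) (fakeGen : ∀ l, Bits (C l) → Bits (M l) → PMF (Bits (K l)))
    (l : ℕ) (m : Bits (M l)) : PMF (Bits (C l ⊕ K l)) :=
  (E.setup l).bind fun k => (E.enc l k fun _ => false).bind fun ct =>
    (fakeGen l ct m).bind fun fk => PMF.pure (Sum.elim ct fk)

end PrivKeyEnc

/-- The probability that the circuit `D` outputs `1` on an input drawn from `p`. -/
def acceptProb {I : Type} [Fintype I] [DecidableEq I] (D : QCircuit I Unit) (p : PMF (Bits I)) :
    ℝ :=
  ∑ x, (p x).toReal * D.prob x fun _ => true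

/-- The fake-key property against (non-uniform) quantum polynomial-time distinguishers. No bound on
the running time of `fakeGen` is imposed, so this is implied by the property for an efficient one. -/
def HasFakeKeyProperty {K M C : ℕ → Type} [∀ l, Fintype (K l)] [∀ l, DecidableEq (K l)]
    [∀ l, Fintype (C l)] [∀ l, DecidableEq (C l)] (E : PrivKeyEnc K M C) : Prop :=
  ∃ fakeGen : ∀ l, Bits (C l) → Bits (M l) → PMF (Bits (K l)),
    ∀ D : ∀ l, QCircuit (C l ⊕ K l) Unit, PolyBounded (fun l => (D l).size) →
      ∃ ε : ℕ → ℝ, Negligible ε ∧ ∀ l, ∀ m : Bits (M l),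
        |acceptProb (D l) (E.realDist l m) - acceptProb (D l) (E.fakeDist fakeGen l m)| ≤ ε l

/-! ### Quantum encryption of classical messages and uncloneable security -/

/-- A private-key scheme that encrypts classical messages into quantum states: `enc l k m` is the
density operator of the ciphertext, and decryption with key `k` is the measurement whose POVM
element for the outcome `m` is `dec l k m`. -/
structure QEnc (K M C : ℕ → Type) [∀ l, Fintype (M l)] [∀ l, DecidableEq (M l)]
    [∀ l, Fintype (C l)] [∀ l, DecidableEq (C l)] where
  setup : ∀ l, PMF (Bits (K l))
  enc : ∀ l, Bits (K l) → Bits (M l) → Op (C l)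
  enc_posSemidef : ∀ l k m, (enc l k m).PosSemidef
  enc_trace : ∀ l k m, (enc l k m).trace = 1
  dec : ∀ l, Bits (K l) → Bits (M l) → Op (C l)
  dec_posSemidef : ∀ l k m, (dec l k m).PosSemidef
  dec_sum : ∀ l k, ∑ m, dec l k m = 1

/-- A cloning adversary: Alice splits the ciphertext into two registers; Bob and Charlie each get
the key and one of the registers, and each outputs a guess of the message. -/
structure CloningAdversary (K M C : ℕ → Type) where
  bLen : ℕ → ℕ
  cLen : ℕ → ℕ
  alice : ∀ l, QCircuit (C l) (Fin (bLen l) ⊕ Fin (cLen l))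
  bob : ∀ l, QCircuit (K l ⊕ Fin (bLen l)) (M l)
  charlie : ∀ l, QCircuit (K l ⊕ Fin (cLen l)) (M l)

section Cloning

variable {K M C : ℕ → Type} [∀ l, Fintype (K l)] [∀ l, DecidableEq (K l)]
  [∀ l, Fintype (M l)] [∀ l, DecidableEq (M l)] [∀ l, Fintype (C l)] [∀ l, DecidableEq (C l)]

/-- (Non-uniform) quantum polynomial time. -/
def CloningAdversary.IsQPT (A : CloningAdversary K M C) : Prop :=
  PolyBounded (fun l => (A.alice l).size) ∧ PolyBounded (fun l => (A.bob l).size) ∧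
    PolyBounded (fun l => (A.charlie l).size)

/-- The probability that Bob and Charlie both output the message, for the key `k ← Setup` and a
uniformly random message `m`. -/
def cloningSuccess (S : QEnc K M C) (A : CloningAdversary K M C) (l : ℕ) : ℝ :=
  ∑ k, (S.setup l k).toReal * ∑ m : Bits (M l), (Fintype.card (Bits (M l)) : ℝ)⁻¹ *
    (tensor ((A.bob l).effect k m) ((A.charlie l).effect k m) *
      (A.alice l).channel (S.enc l k m)).trace.re

/-- `t`-uncloneable security: every quantum polynomial-time cloning adversary succeeds with
probability at most `2^(-n + t)` plus a negligible term, `n` being the message length. -/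
def IsUncloneableSecure (S : QEnc K M C) (t : ℕ → ℝ) : Prop :=
  ∀ A : CloningAdversary K M C, A.IsQPT → ∃ ε : ℕ → ℝ, Negligible ε ∧
    ∀ l, cloningSuccess S A l ≤ (2 : ℝ) ^ (-(Fintype.card (M l) : ℝ) + t l) + ε l

end Cloning

/-! ### Conjugate encryption -/

/-- The amplitude `⟨y| H^θ |x⟩` of a conjugate-coding (Wiesner) state: qubit `i` encodes `x i` in
the Hadamard basis if `θ i` and in the computational basis otherwise. -/
def wiesner {W : Type} [Fintype W] (θ x y : Bits W) : ℂ :=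
  ∏ i, if θ i then hadamard (y i) (x i) else if y i = x i then 1 else 0

/-- The projector onto `H^θ |x⟩`. -/
def wiesnerState {W : Type} [Fintype W] (θ x : Bits W) : Op W :=
  Matrix.vecMulVec (wiesner θ x) (star (wiesner θ x))

lemma hadamard_star (y x : Bool) : star (hadamard y x) = hadamard y x := by
  unfold hadamard
  split_ifs <;> simp

lemma sqrt_two_aux : (1 / (Real.sqrt 2 : ℂ)) * (1 / (Real.sqrt 2 : ℂ)) = 1 / 2 := by
  have h : (Real.sqrt 2 : ℂ) * (Real.sqrt 2 : ℂ) = 2 := by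
    rw [← Complex.ofReal_mul, Real.mul_self_sqrt (by norm_num)]
    norm_num
  rw [div_mul_div_comm, h, one_mul]

lemma wiesner_star {W : Type} [Fintype W] (θ x y : Bits W) :
    star (wiesner θ x y) = wiesner θ x y := by
  unfold wiesner
  rw [star_prod]
  refine Finset.prod_congr rfl fun i _ => ?_
  split_ifs <;> simp [hadamard_star]

lemma wiesner_completeness {W : Type} [Fintype W] [DecidableEq W] (θ y y' : Bits W) :
    ∑ x, wiesner θ x y * wiesner θ x y' = if y = y' then 1 else 0 := by
  unfold wiesner
  simp_rw [← Finset.prod_mul_distrib]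
  rw [← Fintype.prod_sum (fun i (b : Bool) =>
    (if θ i then hadamard (y i) b else if y i = b then (1 : ℂ) else 0) *
      (if θ i then hadamard (y' i) b else if y' i = b then (1 : ℂ) else 0))]
  have key : ∀ i, (∑ b : Bool,
      (if θ i then hadamard (y i) b else if y i = b then (1 : ℂ) else 0) *
      (if θ i then hadamard (y' i) b else if y' i = b then (1 : ℂ) else 0)) =
      if y i = y' i then 1 else 0 := by
    intro i
    have h := sqrt_two_aux
    generalize y i = a
    generalize y' i = a'
    generalize θ i = c
    simp only [hadamard]
    generalize (1 / (Real.sqrt 2 : ℂ)) = s at h ⊢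
    cases a <;> cases a' <;> cases c <;> simp <;> linear_combination 2 * h
  simp_rw [key]
  rw [Finset.prod_ite_zero]
  simp [funext_iff]

lemma wiesner_symm {W : Type} [Fintype W] (θ x y : Bits W) : wiesner θ x y = wiesner θ y x := by
  unfold wiesner hadamard
  refine Finset.prod_congr rfl fun i _ => ?_
  generalize x i = a
  generalize y i = b
  cases a <;> cases b <;> simp

/-- Conjugate encryption of `n(l)`-bit messages. The key is a uniformly random pair `(θ, r)`, stored
as the left and right half of `Bits (Fin n ⊕ Fin n)`; the message `m` is encrypted as
`H^θ |m ⊕ r⟩`, and decryption measures in the basis `θ` and adds `r` to the outcome. -/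
def conjugateEncryption (n : ℕ → ℕ) :
    QEnc (fun l => Fin (n l) ⊕ Fin (n l)) (fun l => Fin (n l)) (fun l => Fin (n l)) where
  setup l := PMF.uniformOfFintype (Bits (Fin (n l) ⊕ Fin (n l)))
  enc l k m := wiesnerState (fun i => k (.inl i)) (fun i => xor (m i) (k (.inr i)))
  enc_posSemidef l k m := Matrix.posSemidef_vecMulVec_self_star _
  enc_trace l k m := by
    rw [wiesnerState, Matrix.trace_vecMulVec, dotProduct]
    simp only [Pi.star_apply, wiesner_star]
    simp_rw [wiesner_symm _ (fun i => xor (m i) (k (.inr i)))]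
    simp [wiesner_completeness]
  dec l k m := wiesnerState (fun i => k (.inl i)) (fun i => xor (m i) (k (.inr i)))
  dec_posSemidef l k m := Matrix.posSemidef_vecMulVec_self_star _
  dec_sum l k := by
    ext y y'
    rw [Matrix.sum_apply]
    simp only [wiesnerState, Matrix.vecMulVec_apply, Pi.star_apply, wiesner_star, Matrix.one_apply]
    rw [← wiesner_completeness (fun i => k (.inl i)) y y']
    refine Fintype.sum_bijective
      (fun m : Bits (Fin (n l)) => fun i => xor (m i) (k (.inr i))) ?_ _ _ fun m => rfl
    exact Function.Involutive.bijective fun m => by ext i; simp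

/-! ### The reusable scheme -/

lemma sum_toReal {α : Type} [Fintype α] (p : PMF α) : ∑ a, ((p a).toReal : ℂ) = 1 := by
  have h : ∑ a, p a = 1 := by rw [← tsum_fintype (L := .unconditional _)]; exact p.tsum_coe
  rw [← Complex.ofReal_sum, ← ENNReal.toReal_sum fun a _ => p.apply_ne_top a, h]
  simp

lemma tensor_posSemidef {V W : Type} [Fintype V] [DecidableEq V] [Fintype W] [DecidableEq W]
    {A : Op V} {B : Op W} (hA : A.PosSemidef) (hB : B.PosSemidef) : (tensor A B).PosSemidef :=
  (hA.kronecker hB).submatrix _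

lemma tensor_trace {V W : Type} [Fintype V] [DecidableEq V] [Fintype W] [DecidableEq W]
    (A : Op V) (B : Op W) : (tensor A B).trace = A.trace * B.trace := by
  rw [← Matrix.trace_kronecker]
  exact Fintype.sum_equiv (Equiv.sumArrowEquivProdArrow V W Bool) _ _ fun _ => rfl

lemma toReal_nonneg {α : Type} (p : PMF α) (a : α) : (0 : ℂ) ≤ ((p a).toReal : ℂ) := by
  exact_mod_cast ENNReal.toReal_nonneg

/-- The reusable scheme built from a classical scheme `E` and a one-time uncloneable scheme `UE`.
Its key is a key of `E`. To encrypt `m`, sample a fresh key `kUE` of `UE` and output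
`(E.Enc(k, kUE), UE.Enc(kUE, m))`. To decrypt, measure the classical part, decrypt it with `E`, and
decrypt the quantum part with the resulting key of `UE`. -/
def reusableScheme {K KUE M C₁ C₂ : ℕ → Type} [∀ l, Fintype (KUE l)] [∀ l, DecidableEq (KUE l)]
    [∀ l, Fintype (M l)] [∀ l, DecidableEq (M l)] [∀ l, Fintype (C₁ l)] [∀ l, DecidableEq (C₁ l)]
    [∀ l, Fintype (C₂ l)] [∀ l, DecidableEq (C₂ l)]
    (E : PrivKeyEnc K KUE C₁) (UE : QEnc KUE M C₂) : QEnc K M (fun l => C₁ l ⊕ C₂ l) where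
  setup := E.setup
  enc l k m := ∑ kUE, ((UE.setup l kUE).toReal : ℂ) •
    tensor (classicalState (E.enc l k kUE)) (UE.enc l kUE m)
  enc_posSemidef l k m := Matrix.posSemidef_sum _ fun kUE _ =>
    (tensor_posSemidef (Matrix.posSemidef_diagonal_iff.2 fun _ => toReal_nonneg _ _)
      (UE.enc_posSemidef l kUE m)).smul (toReal_nonneg _ _)
  enc_trace l k m := by
    simp [Matrix.trace_sum, Matrix.trace_smul, tensor_trace, UE.enc_trace, classicalState,
      Matrix.trace_diagonal, sum_toReal]
  dec l k m := ∑ ct, ∑ kUE, ((E.dec l k ct kUE).toReal : ℂ) •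
    tensor (Matrix.diagonal (Pi.single ct 1)) (UE.dec l kUE m)
  dec_posSemidef l k m := Matrix.posSemidef_sum _ fun ct _ => Matrix.posSemidef_sum _ fun kUE _ =>
    (tensor_posSemidef (Matrix.posSemidef_diagonal_iff.2 fun x => by
      by_cases h : x = ct
      · subst h; simp
      · simp [h]) (UE.dec_posSemidef l kUE m)).smul (toReal_nonneg _ _)
  dec_sum l k := by
    rw [Finset.sum_comm]
    have h : ∀ ct : Bits (C₁ l), ∑ m, ∑ kUE, ((E.dec l k ct kUE).toReal : ℂ) •
        tensor (Matrix.diagonal (Pi.single ct 1)) (UE.dec l kUE m) =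
        tensor (Matrix.diagonal (Pi.single ct 1)) (1 : Op (C₂ l)) := by
      intro ct
      rw [Finset.sum_comm]
      have h1 : ∀ kUE, ∑ m, tensor (Matrix.diagonal (Pi.single ct (1 : ℂ))) (UE.dec l kUE m) =
          tensor (Matrix.diagonal (Pi.single ct 1)) (1 : Op (C₂ l)) := by
        intro kUE
        rw [← UE.dec_sum l kUE]
        ext y y'
        simp [tensor, Matrix.sum_apply, Finset.mul_sum]
      simp_rw [← Finset.smul_sum, h1, ← Finset.sum_smul, sum_toReal, one_smul]
    simp_rw [h]
    ext y y'
    rw [Matrix.sum_apply]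
    simp only [tensor, Matrix.submatrix_apply, Matrix.kroneckerMap_apply, ← Finset.sum_mul,
      Matrix.diagonal_apply, Matrix.one_apply, Equiv.sumArrowEquivProdArrow]
    have e : y = y' ↔ y ∘ Sum.inl = y' ∘ Sum.inl ∧ y ∘ Sum.inr = y' ∘ Sum.inr := by
      constructor
      · rintro rfl; exact ⟨rfl, rfl⟩
      · rintro ⟨h1, h2⟩
        funext w
        cases w with
        | inl a => exact congrFun h1 a
        | inr a => exact congrFun h2 a
    by_cases h1 : y ∘ Sum.inl = y' ∘ Sum.inl <;> by_cases h2 : y ∘ Sum.inr = y' ∘ Sum.inr <;>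
      simp [e, h1, h2, Pi.single_apply]

end UncloneableEncryption

end

open scoped ComplexOrder Kronecker

set_option linter.unusedSectionVars false

noncomputable section

namespace UncloneableEncryption

/-! The proof combines a hybrid argument with a monogamy-of-entanglement game.

Hybrid. Fix a message `m` and a one-time key `μ = (θ, r)`. The whole cloning experiment is then a
test of the pair `(ct, k)`: prepare `H^θ |m ⊕ r⟩`, run Alice on it together with `ct`, copy `k`, run
Bob and Charlie, and accept if both output `m`. `exists_distinguisher` builds this test as a circuit
of size linear in the sizes of the three adversary circuits. On `(Enc(k, μ), k)` its acceptance
probability, averaged over `μ` and `m`, is the cloning success (`cloningSuccess_eq_sum_acceptProb`).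
The fake-key property allows the input to be replaced by `(ct⁰, FakeGen(ct⁰, μ))`. Since circuits
are non-uniform, the worst pair `(μ, m)` can be hardwired for each security parameter, so a single
negligible function serves all pairs.

After the replacement, Alice's classical ciphertext carries no information on `μ`. It can be fixed,
and the key that Bob and Charlie receive is a random function of `μ`, which may be fixed to its best
value. For fixed `r` the key depends only on `θ`, and what remains is a game in which Alice splits
`H^θ |x⟩` before Bob and Charlie learn `θ` (`sum_winProb_le`, `sum_gameProb_le`).

Monogamy (`monogamy_bound`). For each basis `θ` there is a positive operator `T θ` whose quadratic
form at the shared state `ψ` is the winning weight `s θ`. The vectors `T θ ψ` are almost orthogonal: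
their inner products are at most `c θ θ' * √(s θ) * √(s θ')`, where `c θ θ'` is the largest overlap
of the bases `θ` and `θ'`. Cauchy–Schwarz and a Schur test bound `∑ θ, s θ` by the largest row sum
of `c` times `‖ψ‖ ^ 2`. For Wiesner bases the overlap is `1/√2` to the number of positions where `θ`
and `θ'` differ, and the row sum is `(1 + 1/√2) ^ n`. Dividing by the number `2 ^ n` of bases gives
the bound. -/

/-! ### A monogamy-of-entanglement bound -/

section Monogamy

variable {Θ X A : Type*} [Fintype Θ] [Fintype X] [Fintype A]

/-- If `⟨ψ, u θ⟩ = s θ` and the vectors `u θ` are almost orthogonal, then the `s θ` have a small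
sum. -/
lemma sum_le_of_norm_inner_le {F : Type*} [NormedAddCommGroup F] [InnerProductSpace ℂ F]
    (ψ : F) (u : Θ → F) (s : Θ → ℝ) (hs : ∀ θ, 0 ≤ s θ) (hψ : ∀ θ, inner ℂ ψ (u θ) = (s θ : ℂ))
    (c : Θ → Θ → ℝ) (hc : ∀ θ θ', 0 ≤ c θ θ') (hcs : ∀ θ θ', c θ θ' = c θ' θ)
    {C : ℝ} (hC0 : 0 ≤ C) (hC : ∀ θ, ∑ θ', c θ θ' ≤ C)
    (hu : ∀ θ θ', ‖inner ℂ (u θ) (u θ')‖ ≤ c θ θ' * (√(s θ) * √(s θ'))) :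
    ∑ θ, s θ ≤ C * ‖ψ‖ ^ 2 := by
  set S := ∑ θ, s θ with hS
  have hS0 : 0 ≤ S := Finset.sum_nonneg fun θ _ => hs θ
  have h1 : S ≤ ‖ψ‖ * ‖∑ θ, u θ‖ := by
    have h : inner ℂ ψ (∑ θ, u θ) = (S : ℂ) := by
      rw [inner_sum, hS, Complex.ofReal_sum]
      exact Finset.sum_congr rfl fun θ _ => hψ θ
    have h2 := norm_inner_le_norm (𝕜 := ℂ) ψ (∑ θ, u θ)
    rwa [h, Complex.norm_real, Real.norm_of_nonneg hS0] at h2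
  -- Schur test on the Gram matrix of the `u θ`: the arithmetic-geometric mean inequality replaces
  -- `√(s θ) * √(s θ')` by `(s θ + s θ') / 2`, and the symmetry of `c` reduces both halves to row
  -- sums.
  have h2 : ‖∑ θ, u θ‖ ^ 2 ≤ C * S := by
    have e : (‖∑ θ, u θ‖ : ℝ) ^ 2 = ‖∑ θ, ∑ θ', inner ℂ (u θ) (u θ')‖ := by
      have h := inner_self_eq_norm_sq_to_K (𝕜 := ℂ) (∑ θ, u θ)
      simp only [sum_inner, inner_sum] at h
      rw [Finset.sum_comm] at h
      rw [h]
      simp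
    rw [e]
    calc ‖∑ θ, ∑ θ', inner ℂ (u θ) (u θ')‖
        ≤ ∑ θ, ∑ θ', c θ θ' * ((s θ + s θ') / 2) := by
          refine (norm_sum_le _ _).trans (Finset.sum_le_sum fun θ _ => ?_)
          refine (norm_sum_le _ _).trans (Finset.sum_le_sum fun θ' _ => (hu θ θ').trans ?_)
          refine mul_le_mul_of_nonneg_left ?_ (hc _ _)
          nlinarith [sq_nonneg (√(s θ) - √(s θ')), Real.sq_sqrt (hs θ), Real.sq_sqrt (hs θ')]
      _ = ∑ θ, ∑ θ', c θ θ' * s θ := by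
          have h : ∑ θ, ∑ θ', c θ θ' * s θ' = ∑ θ, ∑ θ', c θ θ' * s θ := by
            rw [Finset.sum_comm]
            exact Finset.sum_congr rfl fun θ _ => Finset.sum_congr rfl fun θ' _ => by rw [hcs]
          have h' : ∑ θ, ∑ θ', c θ θ' * ((s θ + s θ') / 2) =
              (∑ θ, ∑ θ', c θ θ' * s θ + ∑ θ, ∑ θ', c θ θ' * s θ') / 2 := by
            simp only [← Finset.sum_add_distrib, Finset.sum_div]
            exact Finset.sum_congr rfl fun θ _ => Finset.sum_congr rfl fun θ' _ => by ring
          rw [h', h]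
          ring
      _ ≤ ∑ θ, C * s θ := by
          refine Finset.sum_le_sum fun θ _ => ?_
          rw [← Finset.sum_mul]
          exact mul_le_mul_of_nonneg_right (hC θ) (hs θ)
      _ = C * S := by rw [Finset.mul_sum]
  -- `h1` and `h2` give `S * S ≤ C * ‖ψ‖ ^ 2 * S`; cancelling `S` requires it to be positive.
  rcases hS0.eq_or_lt with h0 | h0
  · rw [← h0]; positivity
  · have h3 : S * S ≤ C * ‖ψ‖ ^ 2 * S := by
      calc S * S ≤ (‖ψ‖ * ‖∑ θ, u θ‖) * (‖ψ‖ * ‖∑ θ, u θ‖) := mul_self_le_mul_self hS0 h1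
        _ = ‖ψ‖ ^ 2 * ‖∑ θ, u θ‖ ^ 2 := by ring
        _ ≤ ‖ψ‖ ^ 2 * (C * S) := by gcongr
        _ = _ := by ring
    exact le_of_mul_le_mul_right h3 h0

variable {H : Type*} [NormedAddCommGroup H] [InnerProductSpace ℂ H] [CompleteSpace H]

open ContinuousLinearMap in
/-- Overlap bound for two pairs of commuting measurements. -/
lemma norm_sum_inner_le (β γ β' γ' : X → H →L[ℂ] H)
    (hβ : ∀ v, ∑ x, ‖β x v‖ ^ 2 ≤ ‖v‖ ^ 2) (hγ : ∀ v, ∑ x, ‖γ x v‖ ^ 2 ≤ ‖v‖ ^ 2)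
    (hβ' : ∀ v, ∑ x, ‖β' x v‖ ^ 2 ≤ ‖v‖ ^ 2) (hγ' : ∀ v, ∑ x, ‖γ' x v‖ ^ 2 ≤ ‖v‖ ^ 2)
    (h₁ : ∀ x, Commute (β x) (γ x)) (h₂ : ∀ x x', Commute (β x) (adjoint (γ' x')))
    (g : X → X → ℂ) {c : ℝ} (hc : 0 ≤ c) (hg : ∀ x x', ‖g x x'‖ ≤ c) (p p' : X → H) :
    ‖∑ x, ∑ x', g x x' * inner ℂ (adjoint (β x * γ x) (p x)) (adjoint (β' x' * γ' x') (p' x'))‖ ≤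
      c * (√(∑ x, ‖p x‖ ^ 2) * √(∑ x, ‖p' x‖ ^ 2)) := by
  -- Commutation moves `β x` to the right slot and `γ' x'` to the left one. Each slot then involves
  -- only one of the two families `p`, `p'`, and the index of the other family enters only through a
  -- measurement that can be summed out.
  have key : ∀ x x', inner ℂ (adjoint (β x * γ x) (p x)) (adjoint (β' x' * γ' x') (p' x')) =
      inner ℂ (γ' x' (adjoint (γ x) (p x))) (β x (adjoint (β' x') (p' x'))) := by
    intro x x'
    have h : β x (adjoint (γ' x') (adjoint (β' x') (p' x'))) =
        adjoint (γ' x') (β x (adjoint (β' x') (p' x'))) :=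
      DFunLike.congr_fun (h₂ x x').eq (adjoint (β' x') (p' x'))
    rw [(h₁ x).eq, mul_def, mul_def, adjoint_comp, adjoint_comp, comp_apply, comp_apply,
      adjoint_inner_left, h, adjoint_inner_right]
  have hadj : ∀ (δ : X → H →L[ℂ] H), (∀ v, ∑ x, ‖δ x v‖ ^ 2 ≤ ‖v‖ ^ 2) → ∀ x v,
      ‖adjoint (δ x) v‖ ^ 2 ≤ ‖v‖ ^ 2 := by
    intro δ hδ x v
    have h1 : ‖δ x‖ ≤ 1 := by
      refine opNorm_le_bound _ zero_le_one fun v => ?_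
      rw [one_mul]
      refine le_of_sq_le_sq ?_ (norm_nonneg _)
      exact (Finset.single_le_sum (f := fun x => ‖δ x v‖ ^ 2)
        (fun _ _ => sq_nonneg _) (Finset.mem_univ x)).trans (hδ v)
    have h2 : ‖adjoint (δ x) v‖ ≤ ‖v‖ := by
      refine (le_opNorm _ _).trans ?_
      rw [LinearIsometryEquiv.norm_map]
      exact mul_le_of_le_one_left (norm_nonneg _) h1
    gcongr
  -- The sum over `x'` is absorbed by `hγ'`; what is left is the adjoint of a single `γ x`, which is
  -- a contraction.
  have e1 : ∑ q : X × X, ‖γ' q.2 (adjoint (γ q.1) (p q.1))‖ ^ 2 ≤ ∑ x, ‖p x‖ ^ 2 := by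
    rw [Fintype.sum_prod_type]
    exact Finset.sum_le_sum fun x _ => (hγ' (adjoint (γ x) (p x))).trans (hadj γ hγ x (p x))
  have e2 : ∑ q : X × X, ‖β q.1 (adjoint (β' q.2) (p' q.2))‖ ^ 2 ≤ ∑ x, ‖p' x‖ ^ 2 := by
    rw [Fintype.sum_prod_type_right]
    exact Finset.sum_le_sum fun x _ => (hβ (adjoint (β' x) (p' x))).trans (hadj β' hβ' x (p' x))
  calc _ ≤ ∑ x, ∑ x', c * (‖γ' x' (adjoint (γ x) (p x))‖ * ‖β x (adjoint (β' x') (p' x'))‖) := by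
        refine (norm_sum_le _ _).trans (Finset.sum_le_sum fun x _ => ?_)
        refine (norm_sum_le _ _).trans (Finset.sum_le_sum fun x' _ => ?_)
        rw [norm_mul, key]
        exact mul_le_mul (hg _ _) (norm_inner_le_norm _ _) (norm_nonneg _) hc
    _ = c * ∑ q : X × X, ‖γ' q.2 (adjoint (γ q.1) (p q.1))‖ *
          ‖β q.1 (adjoint (β' q.2) (p' q.2))‖ := by
        simp only [Fintype.sum_prod_type, Finset.mul_sum]
    _ ≤ _ := by
        refine mul_le_mul_of_nonneg_left ?_ hc
        refine (Real.sum_mul_le_sqrt_mul_sqrt _ _ _).trans ?_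
        gcongr

open ContinuousLinearMap in
/-- Bound on the winning probability of a monogamy-of-entanglement game: Alice measures in the basis
`w θ`, and the commuting operators `β θ x`, `γ θ x` describe the measurements by which Bob and
Charlie guess her outcome. -/
theorem monogamy_bound (w : Θ → X → A → ℂ) (c : Θ → Θ → ℝ) (hc : ∀ θ θ', 0 ≤ c θ θ')
    (hcs : ∀ θ θ', c θ θ' = c θ' θ) {C : ℝ} (hC0 : 0 ≤ C) (hC : ∀ θ, ∑ θ', c θ θ' ≤ C)
    (hw : ∀ θ θ' x x', ‖∑ a, w θ x a * star (w θ' x' a)‖ ≤ c θ θ')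
    (β γ : Θ → X → H →L[ℂ] H) (hβ : ∀ θ v, ∑ x, ‖β θ x v‖ ^ 2 ≤ ‖v‖ ^ 2)
    (hγ : ∀ θ v, ∑ x, ‖γ θ x v‖ ^ 2 ≤ ‖v‖ ^ 2)
    (h₁ : ∀ θ x, Commute (β θ x) (γ θ x))
    (h₂ : ∀ θ θ' x x', Commute (β θ x) (adjoint (γ θ' x'))) (L : A → H) :
    ∑ θ, ∑ x, ‖(β θ x * γ θ x) (∑ a, w θ x a • L a)‖ ^ 2 ≤ C * ∑ a, ‖L a‖ ^ 2 := by
  set N : Θ → X → H →L[ℂ] H := fun θ x => β θ x * γ θ x with hN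
  set p : Θ → X → H := fun θ x => N θ x (∑ a, w θ x a • L a) with hp
  -- With `M x` the map from `⊕_a H` to `H` that sends `L` to `N θ x (∑ a, w θ x a • L a)`, the
  -- vector `u θ` is `∑ x, (M x)† (M x) ψ`. Hence `⟨ψ, u θ⟩` is the winning weight in basis `θ`, and
  -- inner products of the `u θ` factor into basis overlaps and inner products in `H`.
  let ψ : PiLp 2 (fun _ : A => H) := WithLp.toLp 2 L
  let u : Θ → PiLp 2 (fun _ : A => H) := fun θ =>
    WithLp.toLp 2 fun a => ∑ x, star (w θ x a) • adjoint (N θ x) (p θ x)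
  have hψ2 : ‖ψ‖ ^ 2 = ∑ a, ‖L a‖ ^ 2 := PiLp.norm_sq_eq_of_L2 _ _
  rw [← hψ2]
  refine sum_le_of_norm_inner_le ψ u (fun θ => ∑ x, ‖p θ x‖ ^ 2)
    (fun θ => Finset.sum_nonneg fun _ _ => sq_nonneg _) ?_ c hc hcs hC0 hC ?_
  · intro θ
    rw [PiLp.inner_apply]
    simp only [ψ, u, inner_sum]
    rw [Finset.sum_comm, Complex.ofReal_sum]
    refine Finset.sum_congr rfl fun x _ => ?_
    have h : ∑ a, inner ℂ (L a) (star (w θ x a) • adjoint (N θ x) (p θ x)) =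
        inner ℂ (N θ x (∑ a, w θ x a • L a)) (p θ x) := by
      rw [← adjoint_inner_right, sum_inner]
      refine Finset.sum_congr rfl fun a _ => ?_
      rw [inner_smul_left, inner_smul_right]
      rfl
    rw [h]
    simp [hp]
  · intro θ θ'
    have h : inner ℂ (u θ) (u θ') = ∑ x, ∑ x', (∑ a, w θ x a * star (w θ' x' a)) *
        inner ℂ (adjoint (N θ x) (p θ x)) (adjoint (N θ' x') (p θ' x')) := by
      rw [PiLp.inner_apply]
      simp only [u, sum_inner, inner_sum, inner_smul_left, inner_smul_right, Finset.sum_mul,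
        Finset.mul_sum]
      rw [Finset.sum_comm_cycle]
      refine Finset.sum_congr rfl fun x _ => ?_
      rw [Finset.sum_comm]
      refine Finset.sum_congr rfl fun x' _ =>
        Finset.sum_congr rfl fun a _ => ?_
      simp only [starRingEnd_apply, star_star]
      ring
    rw [h]
    exact norm_sum_inner_le _ _ _ _ (hβ θ) (hγ θ) (hβ θ') (hγ θ') (h₁ θ) (h₂ θ θ') _ (hc θ θ')
      (hw θ θ') _ _

end Monogamy

/-! ### Tensor products of operators -/

section Tensor

variable {V W : Type}

lemma tensor_mul [Fintype V] [DecidableEq V] [Fintype W] [DecidableEq W] (A A' : Op V) (B B' : Op W) :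
    tensor A B * tensor A' B' = tensor (A * A') (B * B') := by
  rw [tensor, tensor, tensor, Matrix.submatrix_mul_equiv, ← Matrix.mul_kronecker_mul]

lemma tensor_conjTranspose (A : Op V) (B : Op W) :
    (tensor A B).conjTranspose = tensor A.conjTranspose B.conjTranspose := by
  rw [tensor, Matrix.conjTranspose_submatrix, Matrix.conjTranspose_kronecker, tensor]

lemma tensor_one_one [Fintype V] [Fintype W] : tensor (1 : Op V) (1 : Op W) = 1 := by
  rw [tensor, Matrix.one_kronecker_one, Matrix.submatrix_one_equiv]

lemma tensor_sum_left {ι : Type*} (s : Finset ι) (A : ι → Op V) (B : Op W) :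
    tensor (∑ i ∈ s, A i) B = ∑ i ∈ s, tensor (A i) B := by
  ext y z
  simp [tensor, Matrix.sum_apply, Finset.sum_mul]

lemma tensor_sum_right {ι : Type*} (s : Finset ι) (A : Op V) (B : ι → Op W) :
    tensor A (∑ i ∈ s, B i) = ∑ i ∈ s, tensor A (B i) := by
  ext y z
  simp [tensor, Matrix.sum_apply, Finset.mul_sum]

lemma tensor_apply (A : Op V) (B : Op W) (y z : Bits (V ⊕ W)) :
    tensor A B y z = A (y ∘ Sum.inl) (z ∘ Sum.inl) * B (y ∘ Sum.inr) (z ∘ Sum.inr) := rfl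

/-- Sums over the bit strings of a register with two parts. -/
lemma sum_bits_sum [Fintype V] [DecidableEq V] [Fintype W] [DecidableEq W] {M : Type*}
    [AddCommMonoid M] (F : Bits (V ⊕ W) → M) : ∑ z, F z = ∑ u, ∑ v, F (Sum.elim u v) := by
  rw [← Fintype.sum_prod_type']
  exact (Fintype.sum_equiv (Equiv.sumArrowEquivProdArrow V W Bool).symm _ _ fun _ => rfl).symm

end Tensor

/-! ### The monogamy bound for conjugate coding -/

section ConjugateCoding

variable {W : Type} [Fintype W]

/-- The maximal overlap of an element of the Wiesner basis `θ` with one of the basis `θ'`. -/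
def basisOverlap (θ θ' : Bits W) : ℝ := ∏ i, if θ i = θ' i then 1 else 1 / √2

lemma basisOverlap_nonneg (θ θ' : Bits W) : 0 ≤ basisOverlap θ θ' :=
  Finset.prod_nonneg fun i _ => by split_ifs <;> positivity

lemma basisOverlap_comm (θ θ' : Bits W) : basisOverlap θ θ' = basisOverlap θ' θ := by
  simp only [basisOverlap, eq_comm]

/-- The sum factors over the qubits, each of which contributes `1` for the same basis and `1/√2` for
the other. This row sum is the constant `C` of `monogamy_bound`. -/
lemma sum_basisOverlap [DecidableEq W] (θ : Bits W) :
    ∑ θ', basisOverlap θ θ' = (1 + 1 / √2) ^ Fintype.card W := by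
  unfold basisOverlap
  rw [← Fintype.prod_sum (fun i (b : Bool) => if θ i = b then (1 : ℝ) else 1 / √2)]
  rw [Finset.prod_congr rfl (g := fun _ => 1 + 1 / √2), Finset.prod_const, Finset.card_univ]
  intro i _
  cases θ i <;> simp [add_comm]

/-- The inner product of two Wiesner states is a product over the qubits. A qubit with equal bases
gives `0` or `1`, and one with different bases gives an entry of the Hadamard matrix, of modulus
`1/√2`. -/
lemma norm_sum_wiesner_mul_le [DecidableEq W] (θ θ' x x' : Bits W) :
    ‖∑ a, wiesner θ x a * star (wiesner θ' x' a)‖ ≤ basisOverlap θ θ' := by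
  simp only [wiesner_star]
  unfold wiesner basisOverlap
  simp_rw [← Finset.prod_mul_distrib]
  rw [← Fintype.prod_sum (fun i (b : Bool) =>
    (if θ i then hadamard b (x i) else if b = x i then (1 : ℂ) else 0) *
      (if θ' i then hadamard b (x' i) else if b = x' i then (1 : ℂ) else 0)), norm_prod]
  refine Finset.prod_le_prod (fun i _ => norm_nonneg _) fun i _ => ?_
  have h := sqrt_two_aux
  have hn : ‖(1 / (Real.sqrt 2 : ℂ))‖ = 1 / √2 := by
    simp [abs_of_nonneg (Real.sqrt_nonneg 2)]
  generalize x i = a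
  generalize x' i = a'
  generalize θ i = c
  generalize θ' i = c'
  simp only [hadamard]
  generalize (1 / (Real.sqrt 2 : ℂ)) = s at h hn ⊢
  have h' : s * s + s * s = 1 := by linear_combination 2 * h
  have h2 : ‖s * s + s * s‖ ≤ 1 := by rw [h']; simp
  have hss : 2 * (‖s‖ * ‖s‖) ≤ 1 := by rw [← norm_mul, h]; norm_num
  cases a <;> cases a' <;> cases c <;> cases c' <;> simp [h', -norm_mul] <;>
    first | exact hn.le.trans (by simp) | exact h2 | exact hss

open Matrix in
/-- Quadratic forms of tensor products, through factorizations of the factors. -/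
lemma quadForm_tensor {R S : Type} [Fintype R] [DecidableEq R] [Fintype S] [DecidableEq S]
    (b : Op R) (c : Op S) (v : Bits (R ⊕ S) → ℂ) :
    (star v ⬝ᵥ tensor (bᴴ * b) (cᴴ * c) *ᵥ v).re =
      ‖(toEuclideanCLM (𝕜 := ℂ) (tensor b (1 : Op S)) *
        toEuclideanCLM (𝕜 := ℂ) (tensor (1 : Op R) c) :
          EuclideanSpace ℂ (Bits (R ⊕ S)) →L[ℂ] EuclideanSpace ℂ (Bits (R ⊕ S)))
        (WithLp.toLp 2 v)‖ ^ 2 := by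
  have h : tensor (bᴴ * b) (cᴴ * c) = (tensor b c)ᴴ * tensor b c := by
    rw [tensor_conjTranspose, tensor_mul]
  rw [h, ← map_mul, tensor_mul, one_mul, mul_one, toEuclideanCLM_toLp,
    EuclideanSpace.norm_sq_eq, ← mulVec_mulVec, dotProduct_mulVec, ← star_mulVec, dotProduct]
  simp [Complex.conj_mul', ← Complex.ofReal_pow]

-- Since `‖b i v‖ ^ 2 = ⟨v, (b i)ᴴ * b i v⟩`, completeness of the measurement makes these numbers
-- add up to `‖v‖ ^ 2`. This supplies the hypotheses on `β` and `γ` in `monogamy_bound`.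
open Matrix in
lemma sum_norm_sq_toEuclideanCLM {R ι : Type*} [Fintype R] [DecidableEq R] [Fintype ι]
    (b : ι → Matrix R R ℂ) (hb : ∑ i, (b i)ᴴ * b i = 1) (v : EuclideanSpace ℂ R) :
    ∑ i, ‖toEuclideanCLM (𝕜 := ℂ) (b i) v‖ ^ 2 = ‖v‖ ^ 2 := by
  have h : ∀ i, ((‖toEuclideanCLM (𝕜 := ℂ) (b i) v‖ ^ 2 : ℝ) : ℂ) =
      inner ℂ v (toEuclideanCLM (𝕜 := ℂ) ((b i)ᴴ * b i) v) := by
    intro i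
    have e : toEuclideanCLM (𝕜 := ℂ) ((b i)ᴴ * b i) v =
        ContinuousLinearMap.adjoint (toEuclideanCLM (𝕜 := ℂ) (b i))
          (toEuclideanCLM (𝕜 := ℂ) (b i) v) := by
      rw [map_mul, ← star_eq_conjTranspose, map_star]
      rfl
    rw [e, ContinuousLinearMap.adjoint_inner_right, inner_self_eq_norm_sq_to_K]
    simp
  have h2 : ((∑ i, ‖toEuclideanCLM (𝕜 := ℂ) (b i) v‖ ^ 2 : ℝ) : ℂ) = ((‖v‖ ^ 2 : ℝ) : ℂ) := by
    rw [Complex.ofReal_sum]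
    simp_rw [h]
    rw [← inner_sum, ← _root_.sum_apply, ← map_sum, hb, map_one,
      one_apply_eq_self, inner_self_eq_norm_sq_to_K]
    simp
  exact_mod_cast h2

open scoped Matrix MatrixOrder in
lemma exists_eq_conjTranspose_mul_self {ι : Type*} [Fintype ι] {M : Matrix ι ι ℂ}
    (hM : M.PosSemidef) : ∃ b : Matrix ι ι ℂ, M = bᴴ * b := by
  classical
  exact CStarAlgebra.nonneg_iff_eq_star_mul_self.mp hM.nonneg

open Matrix in
/-- If the bits `x` are sent through a Kraus operator (with columns `L a`) as the Wiesner state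
`H^θ |x⟩`, then two separate measurements that depend on `θ` cannot both recover `x`. -/
theorem conjugateCoding_bound [DecidableEq W] {R S : Type} [Fintype R] [DecidableEq R] [Fintype S] [DecidableEq S]
    (P : Bits W → Bits W → Op R) (Q : Bits W → Bits W → Op S)
    (hP : ∀ θ x, (P θ x).PosSemidef) (hQ : ∀ θ x, (Q θ x).PosSemidef)
    (hP1 : ∀ θ, ∑ x, P θ x = 1) (hQ1 : ∀ θ, ∑ x, Q θ x = 1) (L : Bits W → Bits (R ⊕ S) → ℂ) :
    ∑ θ, ∑ x, (star (∑ a, wiesner θ x a • L a) ⬝ᵥ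
      tensor (P θ x) (Q θ x) *ᵥ (∑ a, wiesner θ x a • L a)).re ≤
      (1 + 1 / √2) ^ Fintype.card W * ∑ a, ∑ o, ‖L a o‖ ^ 2 := by
  -- The effects need not be projections: any factors `b`, `c` of them serve as measurement
  -- operators, because `monogamy_bound` asks only for a bound on the sums of squared norms. No
  -- dilation to projective measurements is needed.
  have hP' : ∀ θ x, ∃ b : Op R, P θ x = bᴴ * b := fun θ x =>
    exists_eq_conjTranspose_mul_self (hP θ x)
  have hQ' : ∀ θ x, ∃ b : Op S, Q θ x = bᴴ * b := fun θ x =>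
    exists_eq_conjTranspose_mul_self (hQ θ x)
  choose b hb using hP'
  choose c hc using hQ'
  have hcomm : ∀ (A : Op R) (B : Op S), Commute (toEuclideanCLM (𝕜 := ℂ) (tensor A 1))
      (toEuclideanCLM (𝕜 := ℂ) (tensor 1 B)) := by
    intro A B
    rw [commute_iff_eq, ← map_mul, ← map_mul, tensor_mul, tensor_mul]
    simp
  have hβ : ∀ θ (v : EuclideanSpace ℂ (Bits (R ⊕ S))),
      ∑ x, ‖toEuclideanCLM (𝕜 := ℂ) (tensor (b θ x) (1 : Op S)) v‖ ^ 2 ≤ ‖v‖ ^ 2 := by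
    intro θ v
    refine (sum_norm_sq_toEuclideanCLM _ ?_ v).le
    simp_rw [tensor_conjTranspose, tensor_mul, conjTranspose_one, one_mul, ← hb,
      ← tensor_sum_left, hP1, tensor_one_one]
  have hγ : ∀ θ (v : EuclideanSpace ℂ (Bits (R ⊕ S))),
      ∑ x, ‖toEuclideanCLM (𝕜 := ℂ) (tensor (1 : Op R) (c θ x)) v‖ ^ 2 ≤ ‖v‖ ^ 2 := by
    intro θ v
    refine (sum_norm_sq_toEuclideanCLM _ ?_ v).le
    simp_rw [tensor_conjTranspose, tensor_mul, conjTranspose_one, one_mul, ← hc,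
      ← tensor_sum_right, hQ1, tensor_one_one]
  have hadj : ∀ θ x, ContinuousLinearMap.adjoint (toEuclideanCLM (𝕜 := ℂ) (tensor 1 (c θ x))) =
      toEuclideanCLM (𝕜 := ℂ) (tensor (1 : Op R) (c θ x)ᴴ) := by
    intro θ x
    have h : tensor (1 : Op R) (c θ x)ᴴ = star (tensor 1 (c θ x)) := by
      rw [star_eq_conjTranspose, tensor_conjTranspose, conjTranspose_one]
    rw [h, map_star, ContinuousLinearMap.star_eq_adjoint]
  have key := monogamy_bound (H := EuclideanSpace ℂ (Bits (R ⊕ S))) wiesner basisOverlap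
    basisOverlap_nonneg basisOverlap_comm (by positivity) (fun θ => (sum_basisOverlap θ).le)
    norm_sum_wiesner_mul_le (fun θ x => toEuclideanCLM (𝕜 := ℂ) (tensor (b θ x) 1))
    (fun θ x => toEuclideanCLM (𝕜 := ℂ) (tensor 1 (c θ x))) hβ hγ (fun θ x => hcomm _ _)
    (fun θ θ' x x' => by rw [hadj]; exact hcomm _ _) (fun a => WithLp.toLp 2 (L a))
  simp only [EuclideanSpace.norm_sq_eq (WithLp.toLp 2 (L _))] at key
  refine le_trans (le_of_eq ?_) key
  refine Finset.sum_congr rfl fun θ _ => Finset.sum_congr rfl fun x _ => ?_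
  rw [hb, hc, quadForm_tensor, WithLp.toLp_sum]
  rfl

end ConjugateCoding

/-! ### Operators on a part of a register -/

section Lift

lemma agree_extend {V W : Type} {f : V → W} (v : Bits V) (z : Bits W) (w : W)
    (hw : ∀ i, f i ≠ w) : Function.extend f v z w = z w :=
  Function.extend_apply' _ _ _ fun ⟨i, hi⟩ => hw i hi

variable {V W : Type} [Fintype V] [DecidableEq V] [Fintype W] [DecidableEq W]

/-- The operator on `W` that acts as `U` on the wires `f i` and as the identity on the others. -/
def liftOp (f : V → W) (U : Op V) : Op W :=
  Matrix.of fun y z => if ∀ w, (∀ i, f i ≠ w) → y w = z w then U (y ∘ f) (z ∘ f) else 0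

/-- Summation over the bit strings that agree with `z` outside the range of `f`. -/
lemma sum_ite_agree {M : Type*} [AddCommMonoid M] {f : V → W} (hf : f.Injective) (z : Bits W)
    (F : Bits W → M) :
    ∑ y, (if ∀ w, (∀ i, f i ≠ w) → y w = z w then F y else 0) =
      ∑ v : Bits V, F (Function.extend f v z) := by
  rw [← Finset.sum_filter]
  have hy : ∀ y : Bits W, (∀ w, (∀ i, f i ≠ w) → y w = z w) →
      Function.extend f (y ∘ f) z = y := by
    intro y h
    funext w
    by_cases hw : ∃ i, f i = w
    · obtain ⟨i, rfl⟩ := hw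
      rw [hf.extend_apply]
      rfl
    · rw [Function.extend_apply' _ _ _ hw, h w fun i hi => hw ⟨i, hi⟩]
  refine Finset.sum_bij' (fun y _ => y ∘ f) (fun v _ => Function.extend f v z)
    (fun _ _ => Finset.mem_univ _) ?_ ?_ ?_ ?_
  · intro v _
    rw [Finset.mem_filter]
    refine ⟨Finset.mem_univ _, fun w hw => Function.extend_apply' _ _ _ ?_⟩
    rintro ⟨i, hi⟩
    exact hw i hi
  · intro y h
    exact hy y (Finset.mem_filter.1 h).2
  · intro v _
    exact Function.extend_comp hf _ _
  · intro y h
    rw [hy y (Finset.mem_filter.1 h).2]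

-- A gate on the wires `f i` mixes only strings with the same content elsewhere, so a row of the
-- lifted operator is indexed by strings on `V` alone.
open Matrix in
lemma liftOp_mulVec {f : V → W} (hf : f.Injective) (U : Op V) (Ψ : Bits W → ℂ) (y : Bits W) :
    (liftOp f U *ᵥ Ψ) y = ∑ v, U (y ∘ f) v * Ψ (Function.extend f v y) := by
  have h : ∀ z, liftOp f U y z * Ψ z =
      if ∀ w, (∀ i, f i ≠ w) → z w = y w then U (y ∘ f) (z ∘ f) * Ψ z else 0 := by
    intro z
    simp only [liftOp, of_apply, ite_mul, zero_mul]
    simp only [eq_comm]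
  rw [mulVec, dotProduct]
  simp_rw [h]
  rw [sum_ite_agree hf y (fun z => U (y ∘ f) (z ∘ f) * Ψ z)]
  simp_rw [Function.extend_comp hf]

lemma liftOp_mul {f : V → W} (hf : f.Injective) (U U' : Op V) :
    liftOp f U * liftOp f U' = liftOp f (U * U') := by
  ext y z
  have h := liftOp_mulVec hf U (fun t => liftOp f U' t z) y
  change (liftOp f U * liftOp f U') y z = _ at h
  have hz : ∀ v : Bits V, (∀ w, (∀ i, f i ≠ w) → Function.extend f v y w = z w) ↔
      ∀ w, (∀ i, f i ≠ w) → y w = z w := fun v =>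
    forall_congr' fun w => forall_congr' fun hw => by rw [agree_extend v y w hw]
  rw [h]
  simp only [liftOp, Matrix.of_apply, hz, Function.extend_comp hf]
  split_ifs
  · rfl
  · simp

lemma liftOp_one (f : V → W) : liftOp f 1 = 1 := by
  ext y z
  simp only [liftOp, Matrix.of_apply, Matrix.one_apply]
  have h : y = z ↔ (∀ w, (∀ i, f i ≠ w) → y w = z w) ∧ y ∘ f = z ∘ f := by
    constructor
    · rintro rfl; simp
    · rintro ⟨h1, h2⟩
      funext w
      by_cases hw : ∃ i, f i = w
      · obtain ⟨i, rfl⟩ := hw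
        exact congrFun h2 i
      · exact h1 w fun i hi => hw ⟨i, hi⟩
  by_cases h1 : ∀ w, (∀ i, f i ≠ w) → y w = z w
  · rw [if_pos h1]
    exact if_congr (by rw [h]; exact ⟨fun h2 => ⟨h1, h2⟩, fun h2 => h2.2⟩) rfl rfl
  · rw [if_neg h1, if_neg]
    rw [h]
    exact fun h2 => h1 h2.1

open Matrix in
lemma liftOp_conjTranspose (f : V → W) (U : Op V) : (liftOp f U)ᴴ = liftOp f Uᴴ := by
  ext y z
  simp only [liftOp, conjTranspose_apply, of_apply, apply_ite star, star_zero]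
  simp only [eq_comm]

/-- Renaming of the wires of a gate. -/
def Gate.map {V W : Type} (f : V ↪ W) : Gate V → Gate W
  | .x i => .x (f i)
  | .h i => .h (f i)
  | .t i => .t (f i)
  | .cnot i j hij => .cnot (f i) (f j) (f.injective.ne hij)
  | .toffoli i j k hij hik hjk =>
      .toffoli (f i) (f j) (f k) (f.injective.ne hij) (f.injective.ne hik) (f.injective.ne hjk)

/-- The entries of X, CNOT and Toffoli are indicators of an update at one wire. This splits such an
indicator into the agreement condition of `liftOp` and the indicator on the smaller register. -/
lemma eq_update_iff (f : V ↪ W) (y z : Bits W) (i : V) (b : Bool) :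
    y = Function.update z (f i) b ↔
      (∀ w, (∀ i, f i ≠ w) → y w = z w) ∧ y ∘ f = Function.update (z ∘ f) i b := by
  rw [← Function.update_comp_eq_of_injective _ f.injective]
  constructor
  · rintro rfl
    exact ⟨fun w hw => Function.update_of_ne (hw i).symm _ _, rfl⟩
  · rintro ⟨h1, h2⟩
    funext w
    by_cases hw : ∃ i, f i = w
    · obtain ⟨j, rfl⟩ := hw
      exact congrFun h2 j
    · rw [h1 w fun i hi => hw ⟨i, hi⟩, Function.update_of_ne]
      exact fun h => hw ⟨i, h.symm⟩

lemma Gate.unitary_map (f : V ↪ W) (g : Gate V) : (g.map f).unitary = liftOp f g.unitary := by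
  ext y z
  cases g with
  | x i =>
    simp only [Gate.map, Gate.unitary, liftOp, Matrix.of_apply, eq_update_iff, ite_and]
    rfl
  | h i =>
    simp only [Gate.map, Gate.unitary, liftOp, Matrix.of_apply, ← ite_and]
    refine if_congr ?_ rfl rfl
    constructor
    · intro h
      exact ⟨fun w hw => h w (hw i).symm, fun j hj => h _ (f.injective.ne hj)⟩
    · rintro ⟨h1, h2⟩ w hw
      by_cases hw' : ∃ i, f i = w
      · obtain ⟨j, rfl⟩ := hw'
        exact h2 j fun h => hw (by rw [h])
      · exact h1 w fun i hi => hw' ⟨i, hi⟩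
  | t i =>
    -- The phase gate is diagonal, so off the diagonal it vanishes for the same reason as the lifted
    -- identity: strings that agree both outside and on the range of `f` are equal.
    have h := congrFun (congrFun (liftOp_one f) y) z
    simp only [liftOp, Matrix.of_apply, Matrix.one_apply] at h
    simp only [Gate.map, Gate.unitary, liftOp, Matrix.of_apply, Matrix.diagonal_apply,
      Function.comp_apply]
    by_cases hyz : y = z
    · simp [hyz]
    · rw [if_neg hyz] at h ⊢
      by_cases h1 : ∀ w, (∀ i, f i ≠ w) → y w = z w
      · rw [if_pos h1] at h ⊢
        rw [if_neg]
        intro h2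
        simp [h2] at h
      · rw [if_neg h1]
  | cnot i j hij =>
    simp only [Gate.map, Gate.unitary, liftOp, Matrix.of_apply, eq_update_iff, ite_and]
    rfl
  | toffoli i j k _ _ _ =>
    simp only [Gate.map, Gate.unitary, liftOp, Matrix.of_apply, eq_update_iff, ite_and]
    rfl

lemma gatesUnitary_append (a b : List (Gate W)) :
    gatesUnitary (a ++ b) = gatesUnitary b * gatesUnitary a := by
  induction a with
  | nil => simp [gatesUnitary]
  | cons g a ih => simp [gatesUnitary, ih, mul_assoc]

lemma gatesUnitary_map (f : V ↪ W) (gs : List (Gate V)) :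
    gatesUnitary (gs.map (Gate.map f)) = liftOp f (gatesUnitary gs) := by
  induction gs with
  | nil => simp [gatesUnitary, liftOp_one]
  | cons g gs ih =>
    rw [List.map_cons, gatesUnitary, ih, Gate.unitary_map, liftOp_mul f.injective, gatesUnitary]

end Lift

/-! ### Unitarity -/

section Unitarity

variable {W : Type} [Fintype W] [DecidableEq W]

open Matrix

/-- X, CNOT and Toffoli permute the basis states by involutions, so this covers all three. -/
lemma conjTranspose_mul_self_of_injective {π : Bits W → Bits W} (hπ : π.Injective) :
    (of fun y z => if y = π z then (1 : ℂ) else 0)ᴴ * (of fun y z => if y = π z then 1 else 0) =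
      1 := by
  ext z z'
  simp [mul_apply, one_apply, hπ.eq_iff, apply_ite (star : ℂ → ℂ), eq_comm]

/-- This is `wiesner_completeness` for a single qubit in the Hadamard basis, as the matrix is real
and symmetric. -/
lemma hadamard_unitary : (of fun y z : Bits Unit => hadamard (y ()) (z ()))ᴴ *
    (of fun y z : Bits Unit => hadamard (y ()) (z ())) = 1 := by
  ext z z'
  have h := wiesner_completeness (W := Unit) (fun _ => true) z z'
  rw [one_apply, ← h, mul_apply]
  refine Finset.sum_congr rfl fun y _ => ?_
  rw [wiesner_symm _ y z, wiesner_symm _ y z']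
  simp only [conjTranspose_apply, of_apply]
  rw [hadamard_star]
  simp [wiesner]

lemma Gate.unitary_h (i : W) : (Gate.h i).unitary =
    liftOp (fun _ : Unit => i) (of fun y z : Bits Unit => hadamard (y ()) (z ())) := by
  ext y z
  simp only [Gate.unitary, liftOp, of_apply, Function.comp_apply]
  refine if_congr ?_ rfl rfl
  simp [eq_comm]

lemma Gate.unitary_conjTranspose_mul_self (g : Gate W) : g.unitaryᴴ * g.unitary = 1 := by
  cases g with
  | x i =>
    refine conjTranspose_mul_self_of_injective (π := fun z => Function.update z i (!z i))
      (Function.Involutive.injective fun z => ?_)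
    simp
  | h i =>
    rw [Gate.unitary_h, liftOp_conjTranspose, liftOp_mul (fun _ _ _ => rfl), hadamard_unitary, liftOp_one]
  | t i =>
    simp only [Gate.unitary, diagonal_conjTranspose, diagonal_mul_diagonal]
    rw [← diagonal_one]
    congr 1
    funext z
    simp only [Pi.star_apply]
    split_ifs
    · rw [RCLike.star_def, ← Complex.exp_conj, ← Complex.exp_add, map_mul, Complex.conj_I,
        Complex.conj_ofReal, neg_mul, neg_add_cancel, Complex.exp_zero]
    · simp
  | cnot i j hij =>
    refine conjTranspose_mul_self_of_injective
      (π := fun z => Function.update z j (xor (z j) (z i)))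
      (Function.Involutive.injective fun z => ?_)
    simp [Function.update_of_ne hij]
  | toffoli i j k hij hik hjk =>
    refine conjTranspose_mul_self_of_injective
      (π := fun z => Function.update z k (xor (z k) (z i && z j)))
      (Function.Involutive.injective fun z => ?_)
    simp [Function.update_of_ne hik, Function.update_of_ne hjk]

lemma gatesUnitary_conjTranspose_mul_self (gs : List (Gate W)) :
    (gatesUnitary gs)ᴴ * gatesUnitary gs = 1 := by
  induction gs with
  | nil => simp [gatesUnitary]
  | cons g gs ih =>
    rw [gatesUnitary, conjTranspose_mul, Matrix.mul_assoc, ← Matrix.mul_assoc _ (gatesUnitary gs),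
      ih, Matrix.one_mul, g.unitary_conjTranspose_mul_self]

namespace QCircuit

variable {I O K R : Type} [Fintype I] [DecidableEq I] [Fintype O] [DecidableEq O]
  [Fintype K] [DecidableEq K] [Fintype R] [DecidableEq R]

lemma isometry_conjTranspose_mul_self (c : QCircuit I O) : c.isometryᴴ * c.isometry = 1 := by
  ext x x'
  have h := congrFun (congrFun (gatesUnitary_conjTranspose_mul_self c.gates)
    (Sum.elim x fun _ => false)) (Sum.elim x' fun _ => false)
  simp only [mul_apply, conjTranspose_apply, one_apply] at h ⊢
  simp only [isometry, of_apply, h]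
  refine if_congr ⟨fun h => ?_, fun h => by rw [h]⟩ rfl rfl
  exact funext fun i => congrFun h (Sum.inl i)

lemma sum_norm_sq_isometry (c : QCircuit I O) (x : Bits I) : ∑ y, ‖c.isometry y x‖ ^ 2 = 1 := by
  have h := congrFun (congrFun c.isometry_conjTranspose_mul_self x) x
  simp only [mul_apply, conjTranspose_apply, one_apply_eq, RCLike.star_def, Complex.conj_mul'] at h
  exact_mod_cast h

/-- The amplitudes of the circuit on inputs with classical part `k`. -/
def keyedIsometry (c : QCircuit (K ⊕ R) O) (k : Bits K) :
    Matrix (Bits ((K ⊕ R) ⊕ Fin c.anc)) (Bits R) ℂ :=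
  of fun y s => c.isometry y (Sum.elim k s)

/-- The projector onto the event that the output register contains `o`. -/
def outputProj (c : QCircuit I O) (o : Bits O) : Op (I ⊕ Fin c.anc) :=
  diagonal fun y => if ∀ j, y (c.out j) = o j then 1 else 0

lemma outputProj_sq (c : QCircuit I O) (o : Bits O) :
    (c.outputProj o)ᴴ * c.outputProj o = c.outputProj o := by
  rw [outputProj, diagonal_conjTranspose, diagonal_mul_diagonal]
  congr 1
  funext y
  simp only [Pi.star_apply]
  split_ifs <;> simp

lemma sum_outputProj (c : QCircuit I O) : ∑ o, c.outputProj o = 1 := by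
  ext y y'
  rw [Matrix.sum_apply, one_apply]
  simp only [outputProj, diagonal_apply]
  split_ifs
  · have h : ∀ o : Bits O, (∀ j, y (c.out j) = o j) ↔ y ∘ c.out = o := fun o => funext_iff.symm
    simp [h]
  · simp

/-- The output event is a projection and may be inserted twice. The resulting factorization gives
positivity and, in `winProb_eq_sum`, turns traces into sums of squared amplitudes. -/
lemma effect_eq (c : QCircuit (K ⊕ R) O) (k : Bits K) (o : Bits O) :
    c.effect k o = (c.outputProj o * c.keyedIsometry k)ᴴ * (c.outputProj o * c.keyedIsometry k) := by
  rw [conjTranspose_mul, Matrix.mul_assoc, ← Matrix.mul_assoc _ (c.outputProj o), outputProj_sq,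
    ← Matrix.mul_assoc]
  rfl

lemma effect_posSemidef (c : QCircuit (K ⊕ R) O) (k : Bits K) (o : Bits O) :
    (c.effect k o).PosSemidef := by
  rw [effect_eq]
  exact posSemidef_conjTranspose_mul_self _

lemma sum_effect (c : QCircuit (K ⊕ R) O) (k : Bits K) : ∑ o, c.effect k o = 1 := by
  have h : ∀ o, c.effect k o = (c.keyedIsometry k)ᴴ * c.outputProj o * c.keyedIsometry k :=
    fun _ => rfl
  simp_rw [h]
  rw [← Matrix.sum_mul, ← Matrix.mul_sum, sum_outputProj, Matrix.mul_one]
  ext s s'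
  have h := congrFun (congrFun c.isometry_conjTranspose_mul_self (Sum.elim k s)) (Sum.elim k s')
  simp only [mul_apply, conjTranspose_apply, one_apply] at h ⊢
  simp only [keyedIsometry, of_apply, h]
  refine if_congr ⟨fun h => ?_, fun h => by rw [h]⟩ rfl rfl
  exact funext fun i => congrFun h (Sum.inr i)

end QCircuit

end Unitarity

/-! ### The success probability on pure inputs -/

/-- An embedding splits its codomain into its range and the complement. -/
def complEquiv {V W : Type} (f : V ↪ W) : V ⊕ {w : W // ∀ i, f i ≠ w} ≃ W :=
  Equiv.ofBijective (Sum.elim f Subtype.val) <| by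
    constructor
    · refine f.injective.sumElim Subtype.val_injective fun j w h => w.2 j h
    · intro w
      by_cases h : ∃ j, f j = w
      · obtain ⟨j, rfl⟩ := h
        exact ⟨.inl j, rfl⟩
      · exact ⟨.inr ⟨w, fun j hj => h ⟨j, hj⟩⟩, rfl⟩

namespace QCircuit

open Matrix

variable {I O : Type} [Fintype I] [DecidableEq I] [Fintype O] [DecidableEq O]

/-- The wires that are not output wires. -/
abbrev Discarded (c : QCircuit I O) : Type := {w : I ⊕ Fin c.anc // ∀ j, c.out j ≠ w}

/-- Every wire is either an output wire or discarded. -/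
def wireEquiv (c : QCircuit I O) : O ⊕ c.Discarded ≃ I ⊕ Fin c.anc := complEquiv c.out

/-- The contents of all wires, from those of the output wires and of the discarded wires. -/
def joinBits (c : QCircuit I O) (o : Bits O) (g : Bits c.Discarded) : Bits (I ⊕ Fin c.anc) :=
  Sum.elim o g ∘ c.wireEquiv.symm

lemma joinBits_out (c : QCircuit I O) (o : Bits O) (g : Bits c.Discarded) (j : O) :
    c.joinBits o g (c.out j) = o j := by
  have h : c.out j = c.wireEquiv (.inl j) := rfl
  rw [joinBits, Function.comp_apply, h, Equiv.symm_apply_apply, Sum.elim_inl]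

lemma joinBits_discarded (c : QCircuit I O) (o : Bits O) (g : Bits c.Discarded)
    (w : c.Discarded) : c.joinBits o g w.1 = g w := by
  have h : w.1 = c.wireEquiv (.inr w) := rfl
  rw [joinBits, Function.comp_apply, h, Equiv.symm_apply_apply, Sum.elim_inr]

lemma sum_joinBits {M : Type*} [AddCommMonoid M] (c : QCircuit I O)
    (F : Bits (I ⊕ Fin c.anc) → M) : ∑ y, F y = ∑ o, ∑ g, F (c.joinBits o g) := by
  rw [← Fintype.sum_prod_type']
  refine (Fintype.sum_equiv ((Equiv.sumArrowEquivProdArrow _ _ Bool).symm.trans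
    (c.wireEquiv.arrowCongr (Equiv.refl Bool))) _ _ fun p => ?_).symm
  rfl

/-- The conditions in `channel` fix the output wires of both strings and force equal contents `g` on
the discarded ones, so the partial trace is a single sum over `g`. -/
lemma channel_apply (c : QCircuit I O) (ρ : Op I) (o o' : Bits O) :
    c.channel ρ o o' =
      ∑ g, (c.isometry * ρ * c.isometryᴴ) (c.joinBits o g) (c.joinBits o' g) := by
  simp only [channel, of_apply]
  simp only [sum_joinBits c, joinBits_out]
  have h : ∀ (a a' : Bits O) (g g' : Bits c.Discarded), ((∀ j, a j = o j) ∧ (∀ j, a' j = o' j) ∧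
      ∀ w, (∀ j, c.out j ≠ w) → c.joinBits a g w = c.joinBits a' g' w) ↔
      a = o ∧ a' = o' ∧ g = g' := by
    intro a a' g g'
    rw [funext_iff, funext_iff, funext_iff]
    refine and_congr Iff.rfl (and_congr Iff.rfl ⟨fun h w => ?_, fun h w hw => ?_⟩)
    · have := h w.1 w.2
      rwa [joinBits_discarded, joinBits_discarded] at this
    · have := h ⟨w, hw⟩
      rwa [← joinBits_discarded c a g, ← joinBits_discarded c a' g'] at this
  simp only [h, ite_and]
  simp

/-- The (unnormalized) state of the output wires after running the circuit on the input vector `v`,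
when the discarded wires are found to contain `g`. -/
def branch (c : QCircuit I O) (v : Bits I → ℂ) (g : Bits c.Discarded) : Bits O → ℂ :=
  fun o => (c.isometry *ᵥ v) (c.joinBits o g)

/-- Tracing out wires amounts to measuring them and forgetting the result, so a pure input leaves
the mixture of its branches. -/
lemma trace_mul_channel (c : QCircuit I O) (T : Op O) (v : Bits I → ℂ) :
    (T * c.channel (vecMulVec v (star v))).trace =
      ∑ g, star (c.branch v g) ⬝ᵥ T *ᵥ c.branch v g := by
  have h : c.isometry * vecMulVec v (star v) * c.isometryᴴ =
      vecMulVec (c.isometry *ᵥ v) (star (c.isometry *ᵥ v)) := by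
    rw [mul_vecMulVec, vecMulVec_mul, star_mulVec]
  have h2 : c.channel (vecMulVec v (star v)) =
      ∑ g, vecMulVec (c.branch v g) (star (c.branch v g)) := by
    ext o o'
    rw [channel_apply, h, Matrix.sum_apply]
    rfl
  rw [h2, Matrix.mul_sum, trace_sum]
  refine Finset.sum_congr rfl fun g _ => ?_
  rw [mul_vecMulVec, trace_vecMulVec, dotProduct_comm]

end QCircuit

section WinProb

open Matrix

variable {I K R S M : Type} [Fintype I] [DecidableEq I] [Fintype K] [DecidableEq K]
  [Fintype R] [DecidableEq R] [Fintype S] [DecidableEq S] [Fintype M] [DecidableEq M]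

/-- The probability that Bob and Charlie, with key `k`, both output `m` when Alice's input is the
pure state `v`. -/
def winProb (alice : QCircuit I (R ⊕ S)) (bob : QCircuit (K ⊕ R) M) (charlie : QCircuit (K ⊕ S) M)
    (k : Bits K) (m : Bits M) (v : Bits I → ℂ) : ℝ :=
  (tensor (bob.effect k m) (charlie.effect k m) *
    alice.channel (vecMulVec v (star v))).trace.re

lemma quadForm_tensor_rect {Y Z : Type} [Fintype Y] [Fintype Z] (P : Matrix Y (Bits R) ℂ)
    (Q : Matrix Z (Bits S) ℂ) (v : Bits (R ⊕ S) → ℂ) :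
    (star v ⬝ᵥ tensor (Pᴴ * P) (Qᴴ * Q) *ᵥ v).re =
      ∑ y, ∑ z, ‖∑ r, ∑ s, P y r * Q z s * v (Sum.elim r s)‖ ^ 2 := by
  set T : Matrix (Y × Z) (Bits (R ⊕ S)) ℂ :=
    (P ⊗ₖ Q).submatrix id (Equiv.sumArrowEquivProdArrow R S Bool) with hT
  have h : tensor (Pᴴ * P) (Qᴴ * Q) = Tᴴ * T := by
    rw [tensor, mul_kronecker_mul, ← conjTranspose_kronecker, hT, conjTranspose_submatrix,
      ← submatrix_mul _ _ _ _ _ Function.bijective_id]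
  have h2 : ∀ y z, (T *ᵥ v) (y, z) = ∑ r, ∑ s, P y r * Q z s * v (Sum.elim r s) := by
    intro y z
    rw [mulVec, dotProduct, sum_bits_sum]
    rfl
  rw [h, ← mulVec_mulVec, dotProduct_mulVec, ← star_mulVec, dotProduct, Fintype.sum_prod_type,
    Complex.re_sum]
  refine Finset.sum_congr rfl fun y _ => ?_
  rw [Complex.re_sum]
  refine Finset.sum_congr rfl fun z _ => ?_
  rw [← h2, Pi.star_apply, RCLike.star_def, Complex.conj_mul', ← Complex.ofReal_pow,
    Complex.ofReal_re]

/-- The Born rule for one final measurement of all the wires of Bob, of Charlie and of those that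
Alice discards. In this form the game can be compared with a circuit that runs all three parties. -/
lemma winProb_eq_sum (alice : QCircuit I (R ⊕ S)) (bob : QCircuit (K ⊕ R) M)
    (charlie : QCircuit (K ⊕ S) M) (k : Bits K) (m : Bits M) (v : Bits I → ℂ) :
    winProb alice bob charlie k m v = ∑ g, ∑ y, ∑ z,
      if (∀ j, y (bob.out j) = m j) ∧ ∀ j, z (charlie.out j) = m j then
        ‖∑ r, ∑ s, bob.keyedIsometry k y r * charlie.keyedIsometry k z s *
          alice.branch v g (Sum.elim r s)‖ ^ 2
      else 0 := by
  rw [winProb, QCircuit.trace_mul_channel, Complex.re_sum]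
  refine Finset.sum_congr rfl fun g _ => ?_
  rw [QCircuit.effect_eq, QCircuit.effect_eq, quadForm_tensor_rect]
  refine Finset.sum_congr rfl fun y _ => Finset.sum_congr rfl fun z _ => ?_
  simp only [QCircuit.outputProj, diagonal_mul]
  by_cases hy : ∀ j, y (bob.out j) = m j
  · by_cases hz : ∀ j, z (charlie.out j) = m j
    · simp only [if_pos hy, if_pos hz, if_pos (And.intro hy hz), one_mul]
    · simp [if_neg hz, if_neg (not_and_of_not_right _ hz)]
  · simp [if_neg hy, if_neg (not_and_of_not_left _ hy)]

/-- The vector `|ct⟩ ⊗ H^θ |x⟩`. -/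
def cipherVec {C : Type} [Fintype C] [DecidableEq C] (ct : Bits C) (θ x : Bits M) :
    Bits (C ⊕ M) → ℂ :=
  fun z => if z ∘ Sum.inl = ct then wiesner θ x (z ∘ Sum.inr) else 0

lemma tensor_single_wiesnerState {C : Type} [Fintype C] [DecidableEq C] (ct : Bits C)
    (θ x : Bits M) : tensor (diagonal (Pi.single ct 1)) (wiesnerState θ x) =
      vecMulVec (cipherVec ct θ x) (star (cipherVec ct θ x)) := by
  ext y z
  simp only [tensor_apply, wiesnerState, vecMulVec_apply, cipherVec, Pi.star_apply, diagonal_apply,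
    Pi.single_apply, apply_ite (star : ℂ → ℂ), star_zero]
  by_cases hy : y ∘ Sum.inl = ct <;> by_cases hz : z ∘ Sum.inl = ct <;>
    by_cases h : y ∘ Sum.inl = z ∘ Sum.inl <;> simp_all

lemma mulVec_cipherVec {C Y : Type} [Fintype C] [DecidableEq C] (A : Matrix Y (Bits (C ⊕ M)) ℂ)
    (ct : Bits C) (θ x : Bits M) (y : Y) :
    (A *ᵥ cipherVec ct θ x) y = ∑ a, wiesner θ x a * A y (Sum.elim ct a) := by
  rw [mulVec, dotProduct, sum_bits_sum]
  have hr : ∀ (c : Bits C) (a : Bits M), (Sum.elim c a : Bits (C ⊕ M)) ∘ Sum.inr = a :=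
    fun _ _ => rfl
  have hl : ∀ (c : Bits C) (a : Bits M), (Sum.elim c a : Bits (C ⊕ M)) ∘ Sum.inl = c :=
    fun _ _ => rfl
  simp only [cipherVec, hl, hr, mul_ite, mul_zero]
  rw [Finset.sum_comm]
  simp [mul_comm]

/-- One-time uncloneability of conjugate encryption, for fixed `ct` and `r` and a key given to Bob
and Charlie that may depend on the basis `θ`. -/
theorem sum_winProb_le {C : Type} [Fintype C] [DecidableEq C] (alice : QCircuit (C ⊕ M) (R ⊕ S))
    (bob : QCircuit (K ⊕ R) M) (charlie : QCircuit (K ⊕ S) M) (ct : Bits C) (r : Bits M)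
    (κ : Bits M → Bits K) :
    ∑ θ, ∑ m, winProb alice bob charlie (κ θ) m (cipherVec ct θ fun i => xor (m i) (r i)) ≤
      (1 + 1 / √2) ^ Fintype.card M * 2 ^ Fintype.card M := by
  -- For fixed `r`, summing over messages is summing over encoded strings `x = m ⊕ r`. Bob and
  -- Charlie guess `m` exactly when they guess `x`, so their effects are relabelled by `e`.
  let e : Bits M ≃ Bits M := Function.Involutive.toPerm (fun m i => xor (m i) (r i))
    fun m => by ext i; simp
  have he : ∀ m : Bits M, (fun i => xor (m i) (r i)) = e m := fun _ => rfl
  have hee : ∀ x, e (e x) = x := fun x => by ext i; simp [← he]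
  -- For each content `g` of the discarded wires, `L g` lists the columns of the corresponding Kraus
  -- operator of Alice, with `ct` fixed.
  let L : Bits alice.Discarded → Bits M → Bits (R ⊕ S) → ℂ := fun g a o =>
    alice.isometry (alice.joinBits o g) (Sum.elim ct a)
  have hbranch : ∀ θ x g, alice.branch (cipherVec ct θ x) g = ∑ a, wiesner θ x a • L g a := by
    intro θ x g
    funext o
    simp only [QCircuit.branch, mulVec_cipherVec, Finset.sum_apply, Pi.smul_apply, smul_eq_mul, L]
  -- The columns of Alice's isometry are unit vectors, and there is one for each string `a`.
  have hL : ∑ g, ∑ a, ∑ o, ‖L g a o‖ ^ 2 = 2 ^ Fintype.card M := by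
    rw [Finset.sum_comm]
    have : ∀ a, ∑ g, ∑ o, ‖L g a o‖ ^ 2 = 1 := by
      intro a
      rw [Finset.sum_comm, ← alice.sum_norm_sq_isometry (Sum.elim ct a), alice.sum_joinBits]
    simp [this]
  calc _ = ∑ θ, ∑ x, winProb alice bob charlie (κ θ) (e x) (cipherVec ct θ x) := by
        refine Finset.sum_congr rfl fun θ _ => ?_
        exact Fintype.sum_equiv e _ _ fun m => by rw [hee, he]
    _ = ∑ g, ∑ θ, ∑ x, (star (∑ a, wiesner θ x a • L g a) ⬝ᵥ
          tensor (bob.effect (κ θ) (e x)) (charlie.effect (κ θ) (e x)) *ᵥ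
            (∑ a, wiesner θ x a • L g a)).re := by
        simp only [winProb, QCircuit.trace_mul_channel, Complex.re_sum, hbranch]
        rw [Finset.sum_comm_cycle]
    _ ≤ ∑ g, (1 + 1 / √2) ^ Fintype.card M * ∑ a, ∑ o, ‖L g a o‖ ^ 2 := by
        refine Finset.sum_le_sum fun g _ => ?_
        refine conjugateCoding_bound _ _ (fun _ _ => bob.effect_posSemidef _ _)
          (fun _ _ => charlie.effect_posSemidef _ _) (fun θ => ?_) (fun θ => ?_) (L g)
        · rw [← bob.sum_effect (κ θ)]
          exact Fintype.sum_equiv e _ _ fun _ => rfl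
        · rw [← charlie.sum_effect (κ θ)]
          exact Fintype.sum_equiv e _ _ fun _ => rfl
    _ = _ := by rw [← Finset.mul_sum, hL]

end WinProb

/-! ### Elementary circuits -/

section Elementary

open Matrix

variable {W : Type} [Fintype W] [DecidableEq W]

/-- The basis vector `|z⟩`. -/
abbrev basisVec (z : Bits W) : Bits W → ℂ := Pi.single z 1

lemma mulVec_basisVec (U : Op W) (y z : Bits W) : (U *ᵥ basisVec z) y = U y z := by
  simp

lemma gatesUnitary_nil_mulVec (Ψ : Bits W → ℂ) : gatesUnitary [] *ᵥ Ψ = Ψ :=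
  one_mulVec Ψ

lemma gatesUnitary_cons_mulVec (g : Gate W) (gs : List (Gate W)) (Ψ : Bits W → ℂ) :
    gatesUnitary (g :: gs) *ᵥ Ψ = gatesUnitary gs *ᵥ (g.unitary *ᵥ Ψ) := by
  rw [gatesUnitary, mulVec_mulVec]

lemma gatesUnitary_append_mulVec (a b : List (Gate W)) (Ψ : Bits W → ℂ) :
    gatesUnitary (a ++ b) *ᵥ Ψ = gatesUnitary b *ᵥ (gatesUnitary a *ᵥ Ψ) := by
  rw [gatesUnitary_append, mulVec_mulVec]

lemma Gate.x_mulVec (i : W) (z : Bits W) :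
    (Gate.x i).unitary *ᵥ basisVec z = basisVec (Function.update z i (!z i)) := by
  ext y
  simp [Gate.unitary, Pi.single_apply]

lemma Gate.cnot_mulVec (i j : W) (hij : i ≠ j) (z : Bits W) :
    (Gate.cnot i j hij).unitary *ᵥ basisVec z =
      basisVec (Function.update z j (xor (z j) (z i))) := by
  ext y
  simp [Gate.unitary, Pi.single_apply]

lemma Gate.toffoli_mulVec (i j k : W) (hij : i ≠ j) (hik : i ≠ k) (hjk : j ≠ k) (z : Bits W) :
    (Gate.toffoli i j k hij hik hjk).unitary *ᵥ basisVec z =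
      basisVec (Function.update z k (xor (z k) (z i && z j))) := by
  ext y
  simp [Gate.unitary, Pi.single_apply]

/-- Only the factor of qubit `i` in the product amplitude changes: the delta at `x i` becomes a
column of the Hadamard matrix. -/
lemma Gate.h_mulVec_wiesner (i : W) (θ x : Bits W) (hθ : θ i = false) :
    (Gate.h i).unitary *ᵥ wiesner θ x = wiesner (Function.update θ i true) x := by
  ext y
  rw [Gate.unitary_h, liftOp_mulVec (fun _ _ _ => rfl)]
  have hext : ∀ v : Bits Unit, Function.extend (fun _ : Unit => i) v y =
      Function.update y i (v ()) := by
    intro v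
    funext w
    by_cases hw : w = i
    · subst hw
      rw [Function.update_self]
      exact Function.Injective.extend_apply (f := fun _ : Unit => w) (fun _ _ _ => rfl) v y ()
    · rw [Function.update_of_ne hw]
      exact agree_extend v y w fun _ h => hw h.symm
  simp only [hext, of_apply, Function.comp_apply]
  refine (Fintype.sum_equiv (Equiv.funUnique Unit Bool) _
    (fun b => hadamard (y i) b * wiesner θ x (Function.update y i b)) fun _ => rfl).trans ?_
  have hw : ∀ b, wiesner θ x (Function.update y i b) = (if b = x i then 1 else 0) *
      ∏ j ∈ {i}ᶜ, if θ j then hadamard (y j) (x j) else if y j = x j then 1 else 0 := by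
    intro b
    rw [wiesner, Fintype.prod_eq_mul_prod_compl i]
    congr 1
    · simp [hθ]
    · refine Finset.prod_congr rfl fun j hj => ?_
      have hj' : j ≠ i := by simpa using hj
      rw [Function.update_of_ne hj']
  have hw' : wiesner (Function.update θ i true) x y = hadamard (y i) (x i) *
      ∏ j ∈ {i}ᶜ, if θ j then hadamard (y j) (x j) else if y j = x j then 1 else 0 := by
    rw [wiesner, Fintype.prod_eq_mul_prod_compl i]
    congr 1
    · simp
    · refine Finset.prod_congr rfl fun j hj => ?_
      have hj' : j ≠ i := by simpa using hj
      rw [Function.update_of_ne hj']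
  simp_rw [hw]
  rw [hw']
  simp

lemma wiesner_false (x : Bits W) : wiesner (fun _ => false) x = basisVec x := by
  ext y
  simp only [wiesner, Bool.false_eq_true, if_false]
  rw [Finset.prod_ite_zero]
  simp [Pi.single_apply, funext_iff]

lemma hadamardLayer_mulVec (L : List W) (hL : L.Nodup) (θ x : Bits W) (hθ : ∀ i ∈ L, θ i = false) :
    gatesUnitary (L.map Gate.h) *ᵥ wiesner θ x = wiesner (fun i => θ i || decide (i ∈ L)) x := by
  induction L generalizing θ with
  | nil => simp [gatesUnitary_nil_mulVec]
  | cons i L ih =>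
    rw [List.nodup_cons] at hL
    rw [List.map_cons, gatesUnitary_cons_mulVec, Gate.h_mulVec_wiesner _ _ _ (hθ i (by simp)),
      ih hL.2]
    · congr 1
      funext j
      by_cases hj : j = i
      · subst hj; simp
      · simp [hj]
    · intro j hj
      rw [Function.update_of_ne (fun h : j = i => hL.1 (h ▸ hj))]
      exact hθ j (List.mem_cons_of_mem _ hj)

lemma xLayer_mulVec (L : List W) (hL : L.Nodup) (z : Bits W) (hz : ∀ i ∈ L, z i = false) :
    gatesUnitary (L.map Gate.x) *ᵥ basisVec z = basisVec fun i => z i || decide (i ∈ L) := by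
  induction L generalizing z with
  | nil =>
    rw [List.map_nil, gatesUnitary_nil_mulVec]
    simp
  | cons i L ih =>
    rw [List.nodup_cons] at hL
    rw [List.map_cons, gatesUnitary_cons_mulVec, Gate.x_mulVec, ih hL.2]
    · congr 1
      funext j
      by_cases hj : j = i
      · subst hj; simp [hz]
      · simp [hj]
    · intro j hj
      rw [Function.update_of_ne (fun h : j = i => hL.1 (h ▸ hj))]
      exact hz j (List.mem_cons_of_mem _ hj)

/-- Preparation of a Wiesner state. -/
lemma exists_wiesner_gates (θ x : Bits W) : ∃ gs : List (Gate W),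
    gs.length ≤ 2 * Fintype.card W ∧
      gatesUnitary gs *ᵥ basisVec (fun _ => false) = wiesner θ x := by
  -- Flip the qubits where `x` is `1`, then apply Hadamard gates where `θ` is `1`; each layer has at
  -- most one gate per wire.
  refine ⟨(Finset.univ.filter fun i => x i = true).toList.map Gate.x ++
    (Finset.univ.filter fun i => θ i = true).toList.map Gate.h, ?_, ?_⟩
  · simp only [List.length_append, List.length_map, Finset.length_toList]
    have h1 := Finset.card_filter_le (Finset.univ : Finset W) fun i => x i = true
    have h2 := Finset.card_filter_le (Finset.univ : Finset W) fun i => θ i = true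
    rw [Finset.card_univ] at h1 h2
    omega
  · rw [gatesUnitary_append_mulVec, xLayer_mulVec _ (Finset.nodup_toList _) _ (by simp),
      ← wiesner_false, hadamardLayer_mulVec _ (Finset.nodup_toList _) _ _ (by simp)]
    simp

/-- Copying of classical bits. -/
lemma copyLayer_mulVec {K : Type} (src dst : K → W) (hd : dst.Injective)
    (hsd : ∀ i j, src i ≠ dst j) (L : List K) (hL : L.Nodup) (z : Bits W) :
    ∃ z', gatesUnitary (L.map fun i => Gate.cnot (src i) (dst i) (hsd i i)) *ᵥ basisVec z =
        basisVec z' ∧ (∀ i ∈ L, z' (dst i) = xor (z (dst i)) (z (src i))) ∧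
      ∀ w, (∀ i ∈ L, dst i ≠ w) → z' w = z w := by
  induction L generalizing z with
  | nil => exact ⟨z, gatesUnitary_nil_mulVec _, by simp, fun _ _ => rfl⟩
  | cons i L ih =>
    rw [List.nodup_cons] at hL
    obtain ⟨z', h1, h2, h3⟩ := ih hL.2 (Function.update z (dst i) (xor (z (dst i)) (z (src i))))
    refine ⟨z', ?_, ?_, ?_⟩
    · rw [List.map_cons, gatesUnitary_cons_mulVec, Gate.cnot_mulVec, h1]
    · intro j hj
      rcases List.mem_cons.1 hj with rfl | hj
      · rw [h3 _ fun i hi => hd.ne (ne_of_mem_of_not_mem hi hL.1), Function.update_self]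
      · have hji : j ≠ i := fun h => hL.1 (h ▸ hj)
        rw [h2 j hj, Function.update_of_ne (hsd _ _), Function.update_of_ne (hd.ne hji)]
    · intro w hw
      rw [h3 w fun j hj => hw j (List.mem_cons_of_mem _ hj), Function.update_of_ne]
      exact fun h => hw i (by simp) h.symm

/-- Computation of a conjunction of literals with the help of clean ancillas `a`. -/
lemma exists_and_gates (N : ℕ) (lit : Fin N → W) (b : Fin N → Bool) (a : Fin (N + 1) → W)
    (ha : a.Injective) (hla : ∀ i j, lit i ≠ a j) : ∃ gs : List (Gate W),
    gs.length ≤ 2 * N + 1 ∧ ∀ z : Bits W, (∀ j, z (a j) = false) →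
      ∃ z', gatesUnitary gs *ᵥ basisVec z = basisVec z' ∧
        z' (a (Fin.last N)) = decide (∀ i, z (lit i) = b i) ∧
        ∀ w, (∀ j, a j ≠ w) → z' w = z w := by
  induction N with
  | zero =>
    -- The empty conjunction is true, so the first ancilla is set to `1`.
    refine ⟨[Gate.x (a 0)], by simp, fun z hz => ⟨Function.update z (a 0) (!z (a 0)), ?_, ?_, ?_⟩⟩
    · rw [gatesUnitary_cons_mulVec, Gate.x_mulVec, gatesUnitary_nil_mulVec]
    · simp [hz]
    · intro w hw
      rw [Function.update_of_ne (hw 0).symm]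
  | succ N ih =>
    obtain ⟨gs, hlen, hgs⟩ := ih (lit ∘ Fin.castSucc) (b ∘ Fin.castSucc) (a ∘ Fin.castSucc)
      (ha.comp (Fin.castSucc_injective _)) (fun i j => hla _ _)
    have hne : a (Fin.last N).castSucc ≠ a (Fin.last (N + 1)) :=
      ha.ne (Fin.castSucc_lt_last _).ne
    -- With `p` the conjunction so far and `q` the new bit, the Toffoli gate writes `p ∧ q` into the
    -- next ancilla. For a negated literal a CNOT from `p` is added, since `(p ∧ q) ⊕ p = p ∧ ¬q`.
    -- Thus each literal costs at most two gates and one ancilla.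
    refine ⟨gs ++ (Gate.toffoli (lit (Fin.last N)) (a (Fin.last N).castSucc) (a (Fin.last (N + 1)))
      (hla _ _) (hla _ _) hne :: if b (Fin.last N) then [] else
        [Gate.cnot (a (Fin.last N).castSucc) (a (Fin.last (N + 1))) hne]), ?_, ?_⟩
    · split_ifs <;> simp <;> omega
    · intro z hz
      obtain ⟨z', h1, h2, h3⟩ := hgs z fun j => hz _
      have hlast : z' (a (Fin.last (N + 1))) = false := by
        rw [h3 _ fun j => ha.ne (Fin.castSucc_lt_last _).ne, hz]
      have hlit : z' (lit (Fin.last N)) = z (lit (Fin.last N)) := h3 _ fun j => (hla _ _).symm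
      simp only [Function.comp_apply] at h2
      have hdec : decide (∀ i, z (lit i) = b i) =
          (decide (∀ i : Fin N, z (lit i.castSucc) = b i.castSucc) &&
            decide (z (lit (Fin.last N)) = b (Fin.last N))) := by
        rw [← Bool.decide_and]
        exact decide_eq_decide.2 Fin.forall_fin_succ'
      refine ⟨Function.update z' (a (Fin.last (N + 1))) (decide (∀ i, z (lit i) = b i)),
        ?_, Function.update_self .., ?_⟩
      · rw [gatesUnitary_append_mulVec, h1, gatesUnitary_cons_mulVec, Gate.toffoli_mulVec]
        rw [hdec, hlast, hlit, h2]
        generalize decide (∀ i : Fin N, z (lit i.castSucc) = b i.castSucc) = p at h2 ⊢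
        split_ifs with hb
        · rw [hb, gatesUnitary_nil_mulVec]
          simp [Bool.and_comm]
        · rw [gatesUnitary_cons_mulVec, Gate.cnot_mulVec]
          rw [Bool.not_eq_true] at hb
          simp only [Function.update_self, Function.update_of_ne hne, Function.update_idem, h2, hb]
          rw [gatesUnitary_nil_mulVec]
          congr 2
          cases p <;> cases z (lit (Fin.last N)) <;> rfl
      · intro w hw
        rw [Function.update_of_ne (hw _).symm]
        exact h3 w fun j => hw _

end Elementary

/-! ### Circuits on arbitrary sets of wires -/

section Wires

open Matrix

variable {I O W : Type} [Fintype I] [DecidableEq I] [Fintype O] [DecidableEq O]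
  [Fintype W] [DecidableEq W]

/-- A `QCircuit` has wires of the rigid form `I ⊕ Fin anc`. This permits building circuits on any
finite set of wires, those outside the range of `inp` becoming ancillas. -/
lemma exists_circuit (inp : I ↪ W) (gs : List (Gate W)) (out : O ↪ W) :
    ∃ D : QCircuit I O, D.size = Fintype.card W + gs.length ∧ ∀ x o,
      D.prob x o = ∑ y, if ∀ j, y (out j) = o j then
        ‖gatesUnitary gs y (Function.extend inp x fun _ => false)‖ ^ 2 else 0 := by
  let e : I ⊕ Fin (Fintype.card {w : W // ∀ i, inp i ≠ w}) ≃ W :=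
    ((Equiv.refl I).sumCongr (Fintype.equivFin _).symm).trans (complEquiv inp)
  refine ⟨⟨_, gs.map (Gate.map e.symm.toEmbedding), out.trans e.symm.toEmbedding⟩, ?_, ?_⟩
  · have h := Fintype.card_congr e
    rw [Fintype.card_sum, Fintype.card_fin] at h
    simp [QCircuit.size, h]
  · intro x o
    have hext : ∀ w, Function.extend inp x (fun _ => false) w =
        (Sum.elim x fun _ => false : Bits (I ⊕ Fin _)) (e.symm w) := by
      intro w
      obtain ⟨v, rfl⟩ := e.surjective w
      rw [Equiv.symm_apply_apply]
      cases v with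
      | inl i => exact inp.injective.extend_apply _ _ i
      | inr j => exact agree_extend _ _ _ ((Fintype.equivFin _).symm j).2
    rw [QCircuit.prob]
    refine Fintype.sum_equiv (e.arrowCongr (Equiv.refl Bool)) _ _ fun y => ?_
    refine if_congr Iff.rfl ?_ rfl
    simp only [QCircuit.isometry, of_apply, gatesUnitary_map, liftOp]
    rw [if_pos]
    · congr 3
      funext w
      exact (hext w).symm
    · intro w hw
      exact absurd (e.symm_apply_apply w) (hw (e w))

/-- A circuit that tests whether the wires `lit t` contain the bits `b t`. -/
lemma exists_test_circuit {T : Type} [Fintype T] (inp : I ↪ W) (gs : List (Gate W)) (lit : T → W)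
    (b : T → Bool) : ∃ D : QCircuit I Unit,
      D.size ≤ Fintype.card W + gs.length + 3 * Fintype.card T + 2 ∧ ∀ x,
      D.prob x (fun _ => true) = ∑ y, if ∀ t, y (lit t) = b t then
        ‖gatesUnitary gs y (Function.extend inp x fun _ => false)‖ ^ 2 else 0 := by
  classical
  set N := Fintype.card T
  let e : T ≃ Fin N := Fintype.equivFin T
  obtain ⟨gs', hlen, hgs'⟩ := exists_and_gates (W := W ⊕ Fin (N + 1)) N
    (fun i => .inl (lit (e.symm i))) (fun i => b (e.symm i)) Sum.inr Sum.inr_injective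
    (fun _ _ => Sum.inl_ne_inr)
  obtain ⟨D, hsize, hD⟩ := exists_circuit (inp.trans Function.Embedding.inl)
    (gs.map (Gate.map (Function.Embedding.inl (β := Fin (N + 1)))) ++ gs')
    (⟨fun _ : Unit => .inr (Fin.last N), fun _ _ _ => rfl⟩ : Unit ↪ W ⊕ Fin (N + 1))
  refine ⟨D, ?_, fun x => ?_⟩
  · rw [hsize]
    simp
    omega
  rw [hD]
  set z₀ : Bits (W ⊕ Fin (N + 1)) :=
    Function.extend (inp.trans Function.Embedding.inl) x fun _ => false with hz₀
  have hz₀l : z₀ ∘ Sum.inl = Function.extend inp x fun _ => false := by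
    funext w
    by_cases hw : ∃ i, inp i = w
    · obtain ⟨i, rfl⟩ := hw
      rw [inp.injective.extend_apply]
      exact (inp.trans (Function.Embedding.inl (β := Fin (N + 1)))).injective.extend_apply x
        (fun _ => false) i
    · rw [Function.extend_apply' _ _ _ hw]
      exact agree_extend (f := inp.trans (Function.Embedding.inl (β := Fin (N + 1)))) x
        (fun _ => false) _ fun i h => hw ⟨i, Sum.inl_injective h⟩
  have hz₀r : ∀ j, z₀ (.inr j) = false := fun j => agree_extend _ _ _ fun i => Sum.inl_ne_inr
  -- The test gates send `u` with clean ancillas to a single basis state `f u`, which still contains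
  -- `u`. The partial conjunctions left in the ancillas are therefore determined by `u`, and without
  -- any uncomputation no two values of `u` interfere.
  choose f hf1 hf2 hf3 using fun u : Bits W => hgs' (Sum.elim u fun _ => false) fun _ => rfl
  have hfl : ∀ u, f u ∘ Sum.inl = u := fun u => funext fun w => hf3 u (.inl w) fun j => Sum.inr_ne_inl
  have hamp : ∀ u v, gatesUnitary (gs.map (Gate.map (Function.Embedding.inl (β := Fin (N + 1)))) ++
      gs') (Sum.elim u v) z₀ =
      if v = f u ∘ Sum.inr then gatesUnitary gs u (Function.extend inp x fun _ => false) else 0 := by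
    intro u v
    rw [gatesUnitary_append, mul_apply, sum_bits_sum, gatesUnitary_map]
    have h1 : ∀ (u' : Bits W) (v' : Bits (Fin (N + 1))),
        liftOp (Function.Embedding.inl (β := Fin (N + 1))) (gatesUnitary gs) (Sum.elim u' v') z₀ =
        if v' = fun _ => false then gatesUnitary gs u' (Function.extend inp x fun _ => false)
        else 0 := by
      intro u' v'
      simp only [liftOp, of_apply]
      refine if_congr ?_ ?_ rfl
      · constructor
        · intro h
          funext j
          have := h (.inr j) fun i => Sum.inl_ne_inr
          rw [hz₀r] at this
          exact this
        · rintro rfl w hw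
          cases w with
          | inl w => exact absurd rfl (hw w)
          | inr j => exact (hz₀r j).symm
      · rw [← hz₀l]
        rfl
    have h2 : ∀ u' : Bits W, gatesUnitary gs' (Sum.elim u v) (Sum.elim u' fun _ => false) =
        if u' = u then (if v = f u ∘ Sum.inr then 1 else 0) else 0 := by
      intro u'
      rw [← mulVec_basisVec (gatesUnitary gs'), hf1, basisVec, Pi.single_apply, ← ite_and]
      refine if_congr ?_ rfl rfl
      constructor
      · intro h
        have hu : u' = u := by rw [← hfl u', ← h]; rfl
        subst hu
        exact ⟨rfl, by rw [← h]; rfl⟩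
      · rintro ⟨rfl, h⟩
        rw [h]
        funext w
        cases w with
        | inl w => exact (congrFun (hfl u') w).symm
        | inr j => rfl
    simp only [h1, mul_ite, mul_zero, Finset.sum_ite_eq', Finset.mem_univ, if_true, h2, ite_mul,
      one_mul, zero_mul]
  rw [sum_bits_sum]
  refine Finset.sum_congr rfl fun u _ => ?_
  simp only [hamp]
  rw [Finset.sum_eq_single (f u ∘ Sum.inr)]
  · have : (∀ t, u (lit t) = b t) ↔ ∀ i, u (lit (e.symm i)) = b (e.symm i) :=
      (e.symm.forall_congr_right (q := fun t => u (lit t) = b t)).symm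
    have h := hf2 u
    simp only [Sum.elim_inl] at h
    rw [if_pos rfl]
    refine if_congr ?_ rfl rfl
    rw [this]
    exact ⟨fun h' => of_decide_eq_true (h.symm.trans (h' ())), fun h' _ =>
      h.trans (decide_eq_true h')⟩
  · intro v _ hv
    simp [hv]
  · simp

end Wires

/-! ### The cloning game as a distinguisher -/

section Distinguisher

open Matrix

variable {C K R S M : Type} [Fintype C] [DecidableEq C] [Fintype K] [DecidableEq K]
  [Fintype R] [DecidableEq R] [Fintype S] [DecidableEq S] [Fintype M] [DecidableEq M]

lemma extend_middle {V X Y : Type} (v v' : Bits V) (x : Bits X) (y : Bits Y) :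
    Function.extend (fun i : V => (Sum.inl (Sum.inr i) : (X ⊕ V) ⊕ Y)) v
      (Sum.elim (Sum.elim x v') y) = Sum.elim (Sum.elim x v) y := by
  have hinj : Function.Injective fun i : V => (Sum.inl (Sum.inr i) : (X ⊕ V) ⊕ Y) :=
    Sum.inl_injective.comp Sum.inr_injective
  funext w
  rcases w with (w | w) | w
  · exact agree_extend v (Sum.elim (Sum.elim x v') y) _ fun i => by simp
  · exact hinj.extend_apply v (Sum.elim (Sum.elim x v') y) w
  · exact agree_extend v (Sum.elim (Sum.elim x v') y) _ fun i => by simp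

/-- Alice's circuit, preceded by the preparation of the Wiesner state. -/
lemma exists_alice_gates (alice : QCircuit (C ⊕ M) (R ⊕ S)) (θ x : Bits M) :
    ∃ gs : List (Gate ((C ⊕ M) ⊕ Fin alice.anc)),
      gs.length ≤ 2 * Fintype.card M + alice.gates.length ∧ ∀ ct y,
        gatesUnitary gs y (Sum.elim (Sum.elim ct fun _ => false) fun _ => false) =
          (alice.isometry *ᵥ cipherVec ct θ x) y := by
  obtain ⟨gs, hlen, hgs⟩ := exists_wiesner_gates θ x
  let f : M ↪ (C ⊕ M) ⊕ Fin alice.anc :=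
    ⟨fun i => .inl (.inr i), Sum.inl_injective.comp Sum.inr_injective⟩
  refine ⟨gs.map (Gate.map f) ++ alice.gates, by simpa using hlen, fun ct y => ?_⟩
  have hcol : ∀ v, gatesUnitary gs v (fun _ => false) = wiesner θ x v := fun v => by
    rw [← hgs, mulVec_basisVec]
  set z₀ : Bits ((C ⊕ M) ⊕ Fin alice.anc) :=
    Sum.elim (Sum.elim ct fun _ => false) fun _ => false with hz₀
  have hzf : z₀ ∘ f = fun _ => false := rfl
  rw [gatesUnitary_append, gatesUnitary_map, mul_apply, mulVec_cipherVec]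
  simp only [liftOp, of_apply, mul_ite, mul_zero, hzf, hcol]
  rw [sum_ite_agree f.injective z₀ fun t => gatesUnitary alice.gates y t * wiesner θ x (t ∘ f)]
  refine Finset.sum_congr rfl fun a _ => ?_
  rw [Function.extend_comp f.injective, mul_comm]
  congr 2
  exact extend_middle a _ ct _

/-- The wires on which Alice, Bob and Charlie run: Bob's and Charlie's wires, some of which are
output wires of Alice, and the wires that Alice discards. -/
abbrev GameWires (alice : QCircuit (C ⊕ M) (R ⊕ S)) (bob : QCircuit (K ⊕ R) M)
    (charlie : QCircuit (K ⊕ S) M) : Type :=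
  (((K ⊕ R) ⊕ Fin bob.anc) ⊕ ((K ⊕ S) ⊕ Fin charlie.anc)) ⊕ alice.Discarded

set_option synthInstance.maxSize 512

namespace GameWires

variable (alice : QCircuit (C ⊕ M) (R ⊕ S)) (bob : QCircuit (K ⊕ R) M)
  (charlie : QCircuit (K ⊕ S) M)

/-- Bob's wires. -/
def ofBob : (K ⊕ R) ⊕ Fin bob.anc ↪ GameWires alice bob charlie :=
  ⟨fun w => .inl (.inl w), Sum.inl_injective.comp Sum.inl_injective⟩

/-- Charlie's wires. -/
def ofCharlie : (K ⊕ S) ⊕ Fin charlie.anc ↪ GameWires alice bob charlie :=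
  ⟨fun w => .inl (.inr w), Sum.inl_injective.comp Sum.inr_injective⟩

/-- Alice's wires, as output wires and discarded wires. -/
def ofSplit : (R ⊕ S) ⊕ alice.Discarded ↪ GameWires alice bob charlie :=
  ⟨Sum.map (Sum.map (fun i => .inl (.inr i)) fun i => .inl (.inr i)) id,
    ((Sum.inl_injective.comp Sum.inr_injective).sumMap
      (Sum.inl_injective.comp Sum.inr_injective)).sumMap Function.injective_id⟩

/-- Alice's wires. -/
def ofAlice : (C ⊕ M) ⊕ Fin alice.anc ↪ GameWires alice bob charlie :=
  alice.wireEquiv.symm.toEmbedding.trans (ofSplit alice bob charlie)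

/-- The wires with Bob's copy of the key. -/
def keyBob : K ↪ GameWires alice bob charlie :=
  ⟨fun i => .inl (.inl (.inl (.inl i))), fun i j h => by simpa using h⟩

/-- The wires with Charlie's copy of the key. -/
def keyCharlie : K ↪ GameWires alice bob charlie :=
  ⟨fun i => .inl (.inr (.inl (.inl i))), fun i j h => by simpa using h⟩

lemma ofBob_apply (w) : ofBob alice bob charlie w = .inl (.inl w) := rfl

lemma ofCharlie_apply (w) : ofCharlie alice bob charlie w = .inl (.inr w) := rfl

lemma keyBob_apply (i : K) : keyBob alice bob charlie i = .inl (.inl (.inl (.inl i))) := rfl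

lemma keyCharlie_apply (i : K) : keyCharlie alice bob charlie i = .inl (.inr (.inl (.inl i))) := rfl

lemma ofSplit_apply (t) : ofSplit alice bob charlie t =
    Sum.map (Sum.map (fun i => .inl (.inr i)) fun i => .inl (.inr i)) id t := rfl

lemma keyBob_ne_keyCharlie (i j : K) :
    keyBob alice bob charlie i ≠ keyCharlie alice bob charlie j := by
  simp [keyBob_apply, keyCharlie_apply]

lemma ofSplit_ne_keyBob (t) (i : K) : ofSplit alice bob charlie t ≠ keyBob alice bob charlie i := by
  rcases t with (t | t) | t <;> simp [ofSplit_apply, keyBob_apply]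

lemma ofSplit_ne_keyCharlie (t) (i : K) :
    ofSplit alice bob charlie t ≠ keyCharlie alice bob charlie i := by
  rcases t with (t | t) | t <;> simp [ofSplit_apply, keyCharlie_apply]

/-- The wires that carry the input `(ct, k)`. -/
def input : C ⊕ K ↪ GameWires alice bob charlie :=
  ⟨Sum.elim (fun i => ofAlice alice bob charlie (.inl (.inl i))) (keyBob alice bob charlie),
    Function.Injective.sumElim ((ofAlice alice bob charlie).injective.comp
      (Sum.inl_injective.comp Sum.inl_injective)) (keyBob alice bob charlie).injective
      fun _ j => ofSplit_ne_keyBob _ _ _ _ j⟩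

lemma comp_ofAlice (u : Bits ((K ⊕ R) ⊕ Fin bob.anc)) (v : Bits ((K ⊕ S) ⊕ Fin charlie.anc))
    (g : Bits alice.Discarded) :
    (Sum.elim (Sum.elim u v) g : Bits (GameWires alice bob charlie)) ∘ ofAlice alice bob charlie =
      alice.joinBits (Sum.elim (fun i => u (.inl (.inr i))) fun i => v (.inl (.inr i))) g := by
  have h : (Sum.elim (Sum.elim u v) g : Bits (GameWires alice bob charlie)) ∘
      ofSplit alice bob charlie =
      Sum.elim (Sum.elim (fun i => u (.inl (.inr i))) fun i => v (.inl (.inr i))) g := by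
    funext t
    rcases t with (t | t) | t <;> rfl
  rw [QCircuit.joinBits, ← h]
  rfl

/-- The contents of the wires of a circuit before it runs on a zero quantum input and the classical
input `k`. -/
abbrev keyBits {V Y : Type} (k : Bits K) : Bits ((K ⊕ V) ⊕ Y) :=
  Sum.elim (Sum.elim k fun _ => false) fun _ => false

/-- The contents `z` of the wires are as after the copying of the key. -/
structure IsReady (ct : Bits C) (k : Bits K) (z : Bits (GameWires alice bob charlie)) : Prop where
  comp_ofAlice : z ∘ ofAlice alice bob charlie = keyBits ct
  apply_ofBob : ∀ w, (∀ i : R, .inl (.inr i) ≠ w) → z (ofBob alice bob charlie w) = keyBits k w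
  apply_ofCharlie : ∀ w, (∀ i : S, .inl (.inr i) ≠ w) → z (ofCharlie alice bob charlie w) = keyBits k w

variable {alice bob charlie}

/-- The wires that Alice does not touch are exactly the two key copies and the ancillas of Bob and
Charlie, so agreement off her wires splits into one condition for each of them. -/
lemma IsReady.agree_iff {ct : Bits C} {k : Bits K} {z : Bits (GameWires alice bob charlie)}
    (hz : IsReady alice bob charlie ct k z) (u : Bits ((K ⊕ R) ⊕ Fin bob.anc))
    (v : Bits ((K ⊕ S) ⊕ Fin charlie.anc)) (g : Bits alice.Discarded) :
    (∀ w, (∀ i, ofAlice alice bob charlie i ≠ w) → Sum.elim (Sum.elim u v) g w = z w) ↔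
      (∀ w, (∀ i : R, .inl (.inr i) ≠ w) → u w = keyBits k w) ∧
        ∀ w, (∀ i : S, .inl (.inr i) ≠ w) → v w = keyBits k w := by
  have hA : ∀ w, (∀ i, ofAlice alice bob charlie i ≠ w) ↔ ∀ t, ofSplit alice bob charlie t ≠ w :=
    fun w => alice.wireEquiv.symm.forall_congr_right (q := fun t => ofSplit alice bob charlie t ≠ w)
  simp only [hA]
  constructor
  · intro h
    refine ⟨fun w hw => ?_, fun w hw => ?_⟩
    · rw [← hz.apply_ofBob w hw]
      refine h (ofBob alice bob charlie w) ?_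
      rintro ((t | t) | t) ht
      · exact hw t (Sum.inl_injective (Sum.inl_injective ht))
      · simp [ofSplit_apply, ofBob_apply] at ht
      · simp [ofSplit_apply, ofBob_apply] at ht
    · rw [← hz.apply_ofCharlie w hw]
      refine h (ofCharlie alice bob charlie w) ?_
      rintro ((t | t) | t) ht
      · simp [ofSplit_apply, ofCharlie_apply] at ht
      · exact hw t (Sum.inr_injective (Sum.inl_injective ht))
      · simp [ofSplit_apply, ofCharlie_apply] at ht
  · rintro ⟨h1, h2⟩ ((w | w) | w) hw
    · have hw' : ∀ i : R, .inl (.inr i) ≠ w := fun i hi => hw (.inl (.inl i)) (by rw [← hi]; rfl)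
      exact (h1 w hw').trans (hz.apply_ofBob w hw').symm
    · have hw' : ∀ i : S, .inl (.inr i) ≠ w := fun i hi => hw (.inl (.inr i)) (by rw [← hi]; rfl)
      exact (h2 w hw').trans (hz.apply_ofCharlie w hw').symm
    · exact absurd rfl (hw (.inr w))

variable (alice bob charlie) in
/-- The gates that copy Bob's key to Charlie. -/
def copyGates : List (Gate (GameWires alice bob charlie)) :=
  (Finset.univ : Finset K).toList.map fun i => Gate.cnot _ _ (keyBob_ne_keyCharlie alice bob charlie i i)

variable (alice bob charlie) in
lemma exists_isReady (ct : Bits C) (k : Bits K) : ∃ z, IsReady alice bob charlie ct k z ∧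
    gatesUnitary (copyGates alice bob charlie) *ᵥ
      basisVec (Function.extend (input alice bob charlie) (Sum.elim ct k) fun _ => false) =
      basisVec z := by
  set z₀ : Bits (GameWires alice bob charlie) :=
    Function.extend (input alice bob charlie) (Sum.elim ct k) fun _ => false with hz₀
  have hin : ∀ i, z₀ (input alice bob charlie i) = (Sum.elim ct k : Bits (C ⊕ K)) i := fun i =>
    (input alice bob charlie).injective.extend_apply (Sum.elim ct k) (fun _ => false) i
  have hk : ∀ i, z₀ (keyBob alice bob charlie i) = k i := fun i => hin (.inr i)
  have hf : ∀ w, (∀ c, ofAlice alice bob charlie (.inl (.inl c)) ≠ w) →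
      (∀ i, keyBob alice bob charlie i ≠ w) → z₀ w = false := by
    intro w h1 h2
    refine agree_extend (Sum.elim ct k) (fun _ => false) w ?_
    rintro (i | i)
    · exact h1 i
    · exact h2 i
  have hA : z₀ ∘ ofAlice alice bob charlie = keyBits ct := by
    funext w
    rcases w with (w | w) | w
    · exact hin (.inl w)
    · exact hf _ (fun c => (ofAlice alice bob charlie).injective.ne (by simp))
        fun i => (ofSplit_ne_keyBob alice bob charlie _ i).symm
    · exact hf _ (fun c => (ofAlice alice bob charlie).injective.ne (by simp))
        fun i => (ofSplit_ne_keyBob alice bob charlie _ i).symm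
  obtain ⟨z, hz, hzk, hzw⟩ := copyLayer_mulVec _ _ (keyCharlie alice bob charlie).injective
    (keyBob_ne_keyCharlie alice bob charlie) (Finset.univ : Finset K).toList
    (Finset.nodup_toList _) z₀
  have hzw' : ∀ w, (∀ i, keyCharlie alice bob charlie i ≠ w) → z w = z₀ w :=
    fun w hw => hzw w fun i _ => hw i
  refine ⟨z, ⟨?_, ?_, ?_⟩, hz⟩
  · rw [← hA]
    funext w
    exact hzw' _ fun i => (ofSplit_ne_keyCharlie alice bob charlie _ i).symm
  · rintro ((w | w) | w) hw
    · exact (hzw' _ fun i => by simp [keyCharlie_apply, ofBob_apply]).trans (hk w)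
    · exact absurd rfl (hw w)
    · refine (hzw' _ fun i => by simp [keyCharlie_apply, ofBob_apply]).trans (hf _ (fun c hc => ?_) fun i => ?_)
      · change ofSplit alice bob charlie _ = _ at hc
        generalize alice.wireEquiv.symm.toEmbedding (.inl (.inl c)) = t at hc
        rcases t with (t | t) | t <;> simp [ofSplit_apply, ofBob_apply] at hc
      · simp [keyBob_apply, ofBob_apply]
  · rintro ((w | w) | w) hw
    -- Charlie's key wires carry no input and start at `0`, so the CNOT leaves a copy of Bob's key
    -- bit.
    · refine (hzk w (by simp)).trans ?_
      rw [hk, hf _ (fun c => ofSplit_ne_keyCharlie _ _ _ _ w)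
        fun i => keyBob_ne_keyCharlie alice bob charlie i w]
      simp
    · exact absurd rfl (hw w)
    · refine (hzw' _ fun i => by simp [keyCharlie_apply, ofCharlie_apply]).trans
        (hf _ (fun c hc => ?_) fun i => ?_)
      · change ofSplit alice bob charlie _ = _ at hc
        generalize alice.wireEquiv.symm.toEmbedding (.inl (.inl c)) = t at hc
        rcases t with (t | t) | t <;> simp [ofSplit_apply, ofCharlie_apply] at hc
      · simp [keyBob_apply, ofCharlie_apply]

/-- The amplitudes after Alice, Bob and Charlie have run. -/
lemma IsReady.amplitude {ct : Bits C} {k : Bits K} {z : Bits (GameWires alice bob charlie)}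
    (hz : IsReady alice bob charlie ct k z) (gA : List (Gate ((C ⊕ M) ⊕ Fin alice.anc)))
    (u : Bits ((K ⊕ R) ⊕ Fin bob.anc)) (v : Bits ((K ⊕ S) ⊕ Fin charlie.anc))
    (g : Bits alice.Discarded) :
    (gatesUnitary (gA.map (Gate.map (ofAlice alice bob charlie)) ++
      (bob.gates.map (Gate.map (ofBob alice bob charlie)) ++
        charlie.gates.map (Gate.map (ofCharlie alice bob charlie)))) *ᵥ basisVec z)
        (Sum.elim (Sum.elim u v) g) =
      ∑ r, ∑ s, bob.keyedIsometry k u r * charlie.keyedIsometry k v s *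
        gatesUnitary gA (alice.joinBits (Sum.elim r s) g) (keyBits ct) := by
  set F : Bits R → Bits S → ℂ := fun r s =>
    gatesUnitary gA (alice.joinBits (Sum.elim r s) g) (keyBits ct) with hF
  have hextB : ∀ (u u' : Bits ((K ⊕ R) ⊕ Fin bob.anc)) (v : Bits ((K ⊕ S) ⊕ Fin charlie.anc)),
      Function.extend (ofBob alice bob charlie) u' (Sum.elim (Sum.elim u v) g) =
        Sum.elim (Sum.elim u' v) g := by
    intro u u' v
    funext w
    rcases w with (w | w) | w
    · exact (ofBob alice bob charlie).injective.extend_apply u' _ w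
    · exact agree_extend (f := ofBob alice bob charlie) u' _ _ fun i => by simp [ofBob_apply]
    · exact agree_extend (f := ofBob alice bob charlie) u' _ _ fun i => by simp [ofBob_apply]
  have hextC : ∀ (u : Bits ((K ⊕ R) ⊕ Fin bob.anc)) (v v' : Bits ((K ⊕ S) ⊕ Fin charlie.anc)),
      Function.extend (ofCharlie alice bob charlie) v' (Sum.elim (Sum.elim u v) g) =
        Sum.elim (Sum.elim u v') g := by
    intro u v v'
    funext w
    rcases w with (w | w) | w
    · exact agree_extend (f := ofCharlie alice bob charlie) v' _ _ fun i => by simp [ofCharlie_apply]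
    · exact (ofCharlie alice bob charlie).injective.extend_apply v' _ w
    · exact agree_extend (f := ofCharlie alice bob charlie) v' _ _ fun i => by simp [ofCharlie_apply]
  have hcB : ∀ (u : Bits ((K ⊕ R) ⊕ Fin bob.anc)) (v : Bits ((K ⊕ S) ⊕ Fin charlie.anc)),
      (Sum.elim (Sum.elim u v) g : Bits (GameWires alice bob charlie)) ∘ ofBob alice bob charlie =
        u := fun _ _ => rfl
  have hcC : ∀ (u : Bits ((K ⊕ R) ⊕ Fin bob.anc)) (v : Bits ((K ⊕ S) ⊕ Fin charlie.anc)),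
      (Sum.elim (Sum.elim u v) g : Bits (GameWires alice bob charlie)) ∘
        ofCharlie alice bob charlie = v := fun _ _ => rfl
  rw [gatesUnitary_append_mulVec, gatesUnitary_append_mulVec, gatesUnitary_map, gatesUnitary_map,
    gatesUnitary_map, liftOp_mulVec (ofCharlie alice bob charlie).injective]
  simp only [hextC, hcC]
  simp only [liftOp_mulVec (ofBob alice bob charlie).injective, hextB, hcB, mulVec_basisVec]
  -- After Alice alone, the amplitude is supported on strings where the other wires of Bob and
  -- Charlie still hold the key and zeros.
  have hA : ∀ (u : Bits ((K ⊕ R) ⊕ Fin bob.anc)) (v : Bits ((K ⊕ S) ⊕ Fin charlie.anc)),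
      liftOp (ofAlice alice bob charlie) (gatesUnitary gA) (Sum.elim (Sum.elim u v) g) z =
        if ∀ w, (∀ i : S, .inl (.inr i) ≠ w) → v w = keyBits k w then
          if ∀ w, (∀ i : R, .inl (.inr i) ≠ w) → u w = keyBits k w then
            F (u ∘ fun i => .inl (.inr i)) (v ∘ fun i => .inl (.inr i)) else 0 else 0 := by
    intro u v
    simp only [liftOp, of_apply]
    rw [← ite_and]
    refine if_congr ((hz.agree_iff u v g).trans and_comm) ?_ rfl
    rw [GameWires.comp_ofAlice, hz.comp_ofAlice]
    rfl
  have hinjR : Function.Injective fun i : R => (.inl (.inr i) : (K ⊕ R) ⊕ Fin bob.anc) :=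
    Sum.inl_injective.comp Sum.inr_injective
  have hinjS : Function.Injective fun i : S => (.inl (.inr i) : (K ⊕ S) ⊕ Fin charlie.anc) :=
    Sum.inl_injective.comp Sum.inr_injective
  -- On this support only the content `r` of Bob's quantum input is free, and the columns of his
  -- unitary that remain are those of `keyedIsometry`. The same holds for Charlie in `hC`.
  have hB : ∀ (G : Bits R → ℂ), (∑ u', gatesUnitary bob.gates u u' *
      if ∀ w, (∀ i : R, .inl (.inr i) ≠ w) → u' w = keyBits k w then
        G (u' ∘ fun i => .inl (.inr i)) else 0) = ∑ r, bob.keyedIsometry k u r * G r := by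
    intro G
    simp only [mul_ite, mul_zero]
    rw [sum_ite_agree hinjR (keyBits k) fun u' => gatesUnitary bob.gates u u' *
      G (u' ∘ fun i => .inl (.inr i))]
    refine Finset.sum_congr rfl fun r _ => ?_
    rw [Function.extend_comp hinjR, extend_middle]
    rfl
  have hC : ∀ (G : Bits S → ℂ), (∑ v', gatesUnitary charlie.gates v v' *
      if ∀ w, (∀ i : S, .inl (.inr i) ≠ w) → v' w = keyBits k w then
        G (v' ∘ fun i => .inl (.inr i)) else 0) = ∑ s, charlie.keyedIsometry k v s * G s := by
    intro G
    simp only [mul_ite, mul_zero]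
    rw [sum_ite_agree hinjS (keyBits k) fun v' => gatesUnitary charlie.gates v v' *
      G (v' ∘ fun i => .inl (.inr i))]
    refine Finset.sum_congr rfl fun s _ => ?_
    rw [Function.extend_comp hinjS, extend_middle]
    rfl
  have hin : ∀ v' : Bits ((K ⊕ S) ⊕ Fin charlie.anc),
      ∑ u', gatesUnitary bob.gates u u' *
        liftOp (ofAlice alice bob charlie) (gatesUnitary gA) (Sum.elim (Sum.elim u' v') g) z =
      if ∀ w, (∀ i : S, .inl (.inr i) ≠ w) → v' w = keyBits k w then
        ∑ r, bob.keyedIsometry k u r * F r (v' ∘ fun i => .inl (.inr i)) else 0 := by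
    intro v'
    simp only [hA]
    split_ifs
    · exact hB fun r => F r (v' ∘ fun i => .inl (.inr i))
    · simp
  simp only [hin]
  rw [hC fun s => ∑ r, bob.keyedIsometry k u r * F r s, Finset.sum_comm]
  refine Finset.sum_congr rfl fun s _ => ?_
  rw [Finset.mul_sum]
  exact Finset.sum_congr rfl fun r _ => by ring

end GameWires

open GameWires in
/-- The cloning game with fixed message and fixed one-time key can be played by a circuit that gets
the classical ciphertext and the long-term key. -/
theorem exists_distinguisher (alice : QCircuit (C ⊕ M) (R ⊕ S)) (bob : QCircuit (K ⊕ R) M)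
    (charlie : QCircuit (K ⊕ S) M) (θ x m : Bits M) : ∃ D : QCircuit (C ⊕ K) Unit,
      D.size ≤ 9 * alice.size + 2 * bob.size + charlie.size + 2 ∧ ∀ ct k,
        D.prob (Sum.elim ct k) (fun _ => true) =
          winProb alice bob charlie k m (cipherVec ct θ x) := by
  obtain ⟨gA, hlenA, hgA⟩ := exists_alice_gates alice θ x
  obtain ⟨D, hsize, hD⟩ := exists_test_circuit (input alice bob charlie)
    (copyGates alice bob charlie ++ (gA.map (Gate.map (ofAlice alice bob charlie)) ++
      (bob.gates.map (Gate.map (ofBob alice bob charlie)) ++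
        charlie.gates.map (Gate.map (ofCharlie alice bob charlie)))))
    (Sum.elim (fun i => ofBob alice bob charlie (bob.out i))
      fun i => ofCharlie alice bob charlie (charlie.out i)) (Sum.elim m m)
  refine ⟨D, hsize.trans ?_, fun ct k => ?_⟩
  -- The factor `9` bounds the message length counted once among Alice's wires, twice in preparing
  -- the Wiesner state and six times in testing two guesses at cost `3` per bit. The factor `2` pays
  -- for copying the key.
  · have hG : Fintype.card alice.Discarded ≤ Fintype.card ((C ⊕ M) ⊕ Fin alice.anc) :=
      Fintype.card_subtype_le _
    simp only [copyGates, QCircuit.size, Fintype.card_sum, Fintype.card_fin,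
      List.length_append, List.length_map, Finset.length_toList, Finset.card_univ] at hG ⊢
    omega
  obtain ⟨z, hz, hcopy⟩ := exists_isReady alice bob charlie ct k
  rw [hD, winProb_eq_sum, sum_bits_sum, Finset.sum_comm]
  refine Finset.sum_congr rfl fun g _ => ?_
  rw [sum_bits_sum]
  refine Finset.sum_congr rfl fun u _ => Finset.sum_congr rfl fun v _ => ?_
  rw [← mulVec_basisVec (gatesUnitary _), gatesUnitary_append_mulVec, hcopy, hz.amplitude]
  simp only [hgA, QCircuit.branch]
  refine if_congr ?_ rfl rfl
  rw [Sum.forall]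
  rfl

end Distinguisher

/-! ### Expectations and asymptotics -/

section Expectation

variable {α β : Type} [Fintype α] [Fintype β]

lemma sum_toReal_real (p : PMF α) : ∑ a, (p a).toReal = 1 := by
  have h := sum_toReal p
  exact_mod_cast h

lemma sum_bind_toReal_mul (p : PMF α) (g : α → PMF β) (f : β → ℝ) :
    ∑ b, (p.bind g b).toReal * f b = ∑ a, (p a).toReal * ∑ b, (g a b).toReal * f b := by
  have h : ∀ b, (p.bind g b).toReal = ∑ a, (p a).toReal * (g a b).toReal := by
    intro b
    rw [PMF.bind_apply, tsum_fintype, ENNReal.toReal_sum]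
    · simp_rw [ENNReal.toReal_mul]
    · exact fun a _ => ENNReal.mul_ne_top (p.apply_ne_top a) ((g a).apply_ne_top b)
  simp_rw [h, Finset.sum_mul, Finset.mul_sum]
  rw [Finset.sum_comm]
  simp_rw [mul_assoc]

lemma sum_pure_toReal_mul (a : α) (f : α → ℝ) :
    ∑ b, ((PMF.pure a : PMF α) b).toReal * f b = f a := by
  classical
  rw [Finset.sum_eq_single a]
  · simp
  · intro b _ hb
    simp [hb]
  · simp

/-- An average is at most the value at some point. -/
lemma exists_sum_toReal_mul_le (p : PMF α) (f : α → ℝ) : ∃ a, ∑ b, (p b).toReal * f b ≤ f a := by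
  have : Nonempty α := p.support_nonempty.to_subtype.map Subtype.val
  obtain ⟨a, ha⟩ := Finite.exists_max f
  refine ⟨a, ?_⟩
  calc ∑ b, (p b).toReal * f b ≤ ∑ b, (p b).toReal * f a :=
        Finset.sum_le_sum fun b _ => mul_le_mul_of_nonneg_left (ha b) ENNReal.toReal_nonneg
    _ = f a := by rw [← Finset.sum_mul, sum_toReal_real, one_mul]

lemma sum_toReal_mul_le (p : PMF α) {f : α → ℝ} {c : ℝ} (hf : ∀ a, f a ≤ c) :
    ∑ b, (p b).toReal * f b ≤ c := by
  obtain ⟨a, ha⟩ := exists_sum_toReal_mul_le p f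
  exact ha.trans (hf a)

lemma PolyBounded.mono {f g : ℕ → ℕ} (hg : PolyBounded g) (h : ∀ l, f l ≤ g l) : PolyBounded f :=
  hg.imp fun _ hp l => (h l).trans (hp l)

lemma PolyBounded.add {f g : ℕ → ℕ} (hf : PolyBounded f) (hg : PolyBounded g) :
    PolyBounded fun l => f l + g l := by
  obtain ⟨p, hp⟩ := hf
  obtain ⟨q, hq⟩ := hg
  exact ⟨p + q, fun l => by rw [Polynomial.eval_add]; exact add_le_add (hp l) (hq l)⟩

lemma PolyBounded.const_mul {f : ℕ → ℕ} (c : ℕ) (hf : PolyBounded f) :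
    PolyBounded fun l => c * f l := by
  obtain ⟨p, hp⟩ := hf
  exact ⟨Polynomial.C c * p, fun l => by
    rw [Polynomial.eval_mul, Polynomial.eval_C]; exact Nat.mul_le_mul_left c (hp l)⟩

lemma PolyBounded.const (c : ℕ) : PolyBounded fun _ => c :=
  ⟨Polynomial.C c, fun l => by simp⟩

end Expectation

/-! ### The cloning experiment for the reusable scheme -/

open Matrix

lemma QCircuit.channel_sum_smul {I O ι : Type} [Fintype I] [DecidableEq I] [Fintype O]
    [DecidableEq O] (c : QCircuit I O) (s : Finset ι) (a : ι → ℂ) (ρ : ι → Op I) :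
    c.channel (∑ i ∈ s, a i • ρ i) = ∑ i ∈ s, a i • c.channel (ρ i) := by
  ext o o'
  simp only [Matrix.sum_apply, Matrix.smul_apply, channel_apply, Matrix.mul_sum, Matrix.sum_mul,
    Matrix.mul_smul, Matrix.smul_mul, smul_eq_mul, Finset.mul_sum]
  rw [Finset.sum_comm]

lemma tensor_classicalState {V W : Type} [Fintype V] [DecidableEq V] [Fintype W] [DecidableEq W]
    (p : PMF (Bits V)) (B : Op W) : tensor (classicalState p) B =
      ∑ ct, ((p ct).toReal : ℂ) • tensor (diagonal (Pi.single ct 1)) B := by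
  have h : classicalState p = ∑ ct, ((p ct).toReal : ℂ) • diagonal (Pi.single ct (1 : ℂ)) := by
    ext y z
    simp only [classicalState, Matrix.sum_apply, Matrix.smul_apply, diagonal_apply, Pi.single_apply]
    split_ifs <;> simp
  rw [h, tensor_sum_left]
  refine Finset.sum_congr rfl fun ct _ => ?_
  ext y z
  simp [tensor_apply, mul_assoc]

section Game

variable {C K R S M : Type} [Fintype C] [DecidableEq C] [Fintype K] [DecidableEq K]
  [Fintype R] [DecidableEq R] [Fintype S] [DecidableEq S] [Fintype M] [DecidableEq M]

/-- The probability that Bob and Charlie, with long-term key `k`, both output `m` when Alice gets the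
classical ciphertext `ct` and the encryption of `m` under the one-time key `μ`. -/
def gameProb (alice : QCircuit (C ⊕ M) (R ⊕ S)) (bob : QCircuit (K ⊕ R) M)
    (charlie : QCircuit (K ⊕ S) M) (μ : Bits (M ⊕ M)) (m : Bits M) (ct : Bits C) (k : Bits K) : ℝ :=
  winProb alice bob charlie k m
    (cipherVec ct (fun i => μ (.inl i)) fun i => xor (m i) (μ (.inr i)))

/-- If the long-term key is generated from `ct` and the one-time key after the fact, then the cloning
game is the one for conjugate encryption. -/
lemma sum_gameProb_le (alice : QCircuit (C ⊕ M) (R ⊕ S)) (bob : QCircuit (K ⊕ R) M)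
    (charlie : QCircuit (K ⊕ S) M) (ct : Bits C) (q : Bits (M ⊕ M) → PMF (Bits K)) :
    ∑ μ, ∑ m, ∑ k, (q μ k).toReal * gameProb alice bob charlie μ m ct k ≤
      2 ^ Fintype.card M * ((1 + 1 / √2) ^ Fintype.card M * 2 ^ Fintype.card M) := by
  -- The randomness of the key is fixed to the value that is best for the adversary, separately for
  -- each one-time key.
  choose κ hκ using fun μ =>
    exists_sum_toReal_mul_le (q μ) fun k => ∑ m, gameProb alice bob charlie μ m ct k
  calc _ = ∑ μ, ∑ k, (q μ k).toReal * ∑ m, gameProb alice bob charlie μ m ct k := by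
        refine Finset.sum_congr rfl fun μ _ => ?_
        rw [Finset.sum_comm]
        simp_rw [Finset.mul_sum]
    _ ≤ ∑ μ, ∑ m, gameProb alice bob charlie μ m ct (κ μ) :=
        Finset.sum_le_sum fun μ _ => hκ μ
    -- Once `r` is fixed, the key is a function of `θ` alone, as `sum_winProb_le` requires.
    _ = ∑ r : Bits M, ∑ θ, ∑ m, winProb alice bob charlie (κ (Sum.elim θ r)) m
          (cipherVec ct θ fun i => xor (m i) (r i)) := by
        rw [sum_bits_sum, Finset.sum_comm]
        rfl
    _ ≤ ∑ r : Bits M, (1 + 1 / √2) ^ Fintype.card M * 2 ^ Fintype.card M :=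
        Finset.sum_le_sum fun r _ => sum_winProb_le alice bob charlie ct r
          fun θ => κ (Sum.elim θ r)
    _ = _ := by simp

end Game

section Reusable

variable {n keyLen ctLen : ℕ → ℕ}
  (E : PrivKeyEnc (fun l => Fin (keyLen l)) (fun l => Fin (n l) ⊕ Fin (n l))
    (fun l => Fin (ctLen l)))
  (A : CloningAdversary (fun l => Fin (keyLen l)) (fun l => Fin (n l))
    (fun l => Fin (ctLen l) ⊕ Fin (n l))) (l : ℕ)

/-- The ciphertext is a mixture of the pure states `cipherVec`, over the one-time key and the
classical ciphertext, and everything applied to it is linear. -/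
lemma trace_re_reusableScheme (T : Op (Fin (A.bLen l) ⊕ Fin (A.cLen l))) (k : Bits (Fin (keyLen l)))
    (m : Bits (Fin (n l))) :
    (T * (A.alice l).channel ((reusableScheme E (conjugateEncryption n)).enc l k m)).trace.re =
      (Fintype.card (Bits (Fin (n l) ⊕ Fin (n l))) : ℝ)⁻¹ * ∑ μ, ∑ ct, (E.enc l k μ ct).toReal *
        (T * (A.alice l).channel (vecMulVec
          (cipherVec ct (fun i => μ (.inl i)) fun i => xor (m i) (μ (.inr i)))
          (star (cipherVec ct (fun i => μ (.inl i)) fun i => xor (m i) (μ (.inr i)))))).trace.re := by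
  have henc : (reusableScheme E (conjugateEncryption n)).enc l k m =
      ∑ μ, ((Fintype.card (Bits (Fin (n l) ⊕ Fin (n l))) : ℝ)⁻¹ : ℂ) • ∑ ct,
        ((E.enc l k μ ct).toReal : ℂ) • vecMulVec
          (cipherVec ct (fun i => μ (.inl i)) fun i => xor (m i) (μ (.inr i)))
          (star (cipherVec ct (fun i => μ (.inl i)) fun i => xor (m i) (μ (.inr i)))) := by
    change ∑ μ, (((PMF.uniformOfFintype _) μ).toReal : ℂ) • tensor (classicalState (E.enc l k μ))
      (wiesnerState (fun i => μ (.inl i)) fun i => xor (m i) (μ (.inr i))) = _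
    refine Finset.sum_congr rfl fun μ _ => ?_
    rw [tensor_classicalState]
    simp only [tensor_single_wiesnerState, PMF.uniformOfFintype_apply, ENNReal.toReal_inv,
      ENNReal.toReal_natCast, Complex.ofReal_inv]
  rw [henc, QCircuit.channel_sum_smul, Matrix.mul_sum, trace_sum, Complex.re_sum, Finset.mul_sum]
  refine Finset.sum_congr rfl fun μ _ => ?_
  rw [QCircuit.channel_sum_smul, Matrix.mul_smul, trace_smul, Matrix.mul_sum, trace_sum,
    smul_eq_mul, ← Complex.ofReal_inv, Complex.re_ofReal_mul, Complex.re_sum]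
  congr 1
  refine Finset.sum_congr rfl fun ct _ => ?_
  rw [Matrix.mul_smul, trace_smul, smul_eq_mul, Complex.re_ofReal_mul]

/-- The weight of each pair of a message and a one-time key. -/
def pairWeight (n : ℕ) : ℝ :=
  (Fintype.card (Bits (Fin n)) : ℝ)⁻¹ * (Fintype.card (Bits (Fin n ⊕ Fin n)) : ℝ)⁻¹

lemma pairWeight_nonneg (n : ℕ) : 0 ≤ pairWeight n := by
  unfold pairWeight
  positivity

lemma sum_pairWeight (n : ℕ) :
    ∑ _μ : Bits (Fin n ⊕ Fin n), ∑ _m : Bits (Fin n), pairWeight n = 1 := by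
  have h1 : (Fintype.card (Bits (Fin n)) : ℝ) ≠ 0 := Nat.cast_ne_zero.2 Fintype.card_ne_zero
  have h2 : (Fintype.card (Bits (Fin n ⊕ Fin n)) : ℝ) ≠ 0 := Nat.cast_ne_zero.2 Fintype.card_ne_zero
  rw [Finset.sum_const, Finset.sum_const, Finset.card_univ, Finset.card_univ, nsmul_eq_mul,
    nsmul_eq_mul, pairWeight]
  field_simp

variable (D : Bits (Fin (n l) ⊕ Fin (n l)) → Bits (Fin (n l)) →
    QCircuit (Fin (ctLen l) ⊕ Fin (keyLen l)) Unit)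
  (hD : ∀ μ m ct k, (D μ m).prob (Sum.elim ct k) (fun _ => true) =
    gameProb (A.alice l) (A.bob l) (A.charlie l) μ m ct k)

include hD

lemma acceptProb_realDist (μ : Bits (Fin (n l) ⊕ Fin (n l))) (m : Bits (Fin (n l))) :
    acceptProb (D μ m) (E.realDist l μ) = ∑ k, (E.setup l k).toReal *
      ∑ ct, (E.enc l k μ ct).toReal * gameProb (A.alice l) (A.bob l) (A.charlie l) μ m ct k := by
  simp only [acceptProb, PrivKeyEnc.realDist, sum_bind_toReal_mul, sum_pure_toReal_mul, hD]

lemma acceptProb_fakeDist (fakeGen : ∀ l, Bits (Fin (ctLen l)) → Bits (Fin (n l) ⊕ Fin (n l)) →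
      PMF (Bits (Fin (keyLen l)))) (μ : Bits (Fin (n l) ⊕ Fin (n l))) (m : Bits (Fin (n l))) :
    acceptProb (D μ m) (E.fakeDist fakeGen l μ) = ∑ k, (E.setup l k).toReal *
      ∑ ct, (E.enc l k (fun _ => false) ct).toReal * ∑ fk, (fakeGen l ct μ fk).toReal *
        gameProb (A.alice l) (A.bob l) (A.charlie l) μ m ct fk := by
  simp only [acceptProb, PrivKeyEnc.fakeDist, sum_bind_toReal_mul, sum_pure_toReal_mul, hD]

/-- Message and one-time key are drawn independently of the long-term key, so they can be drawn
first; given them, the experiment is the distinguisher on the real distribution. -/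
lemma cloningSuccess_eq_sum_acceptProb :
    cloningSuccess (reusableScheme E (conjugateEncryption n)) A l =
      ∑ μ, ∑ m, pairWeight (n l) * acceptProb (D μ m) (E.realDist l μ) := by
  simp only [cloningSuccess, trace_re_reusableScheme, acceptProb_realDist E A l D hD, pairWeight,
    gameProb, winProb, Finset.mul_sum]
  rw [Finset.sum_comm_cycle]
  refine Finset.sum_congr rfl fun μ _ => ?_
  rw [Finset.sum_comm]
  refine Finset.sum_congr rfl fun m _ => Finset.sum_congr rfl fun k _ =>
    Finset.sum_congr rfl fun ct _ => ?_
  change (E.setup l k).toReal * _ = _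
  ring

/-- Here `ct⁰` is independent of the one-time key, so the average over it can be taken outermost,
and `sum_gameProb_le` applies to each value of `ct⁰`. -/
lemma sum_acceptProb_fakeDist_le (fakeGen : ∀ l, Bits (Fin (ctLen l)) →
      Bits (Fin (n l) ⊕ Fin (n l)) → PMF (Bits (Fin (keyLen l)))) :
    ∑ μ, ∑ m, pairWeight (n l) * acceptProb (D μ m) (E.fakeDist fakeGen l μ) ≤
      (1 / 2 + 1 / (2 * √2)) ^ n l := by
  have h : ∑ μ, ∑ m, pairWeight (n l) * acceptProb (D μ m) (E.fakeDist fakeGen l μ) =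
      ∑ k, (E.setup l k).toReal * ∑ ct, (E.enc l k (fun _ => false) ct).toReal *
        (pairWeight (n l) * ∑ μ, ∑ m, ∑ fk, (fakeGen l ct μ fk).toReal *
          gameProb (A.alice l) (A.bob l) (A.charlie l) μ m ct fk) := by
    simp only [acceptProb_fakeDist E A l D hD, Finset.mul_sum]
    rw [Finset.sum_comm_cycle]
    refine Finset.sum_congr rfl fun k _ => ?_
    rw [Finset.sum_comm_cycle]
    refine Finset.sum_congr rfl fun ct _ => Finset.sum_congr rfl fun μ _ =>
      Finset.sum_congr rfl fun m _ => Finset.sum_congr rfl fun fk _ => ?_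
    ring
  rw [h]
  refine sum_toReal_mul_le _ fun k => sum_toReal_mul_le _ fun ct => ?_
  refine (mul_le_mul_of_nonneg_left (sum_gameProb_le (A.alice l) (A.bob l) (A.charlie l) ct
    (fakeGen l ct)) (pairWeight_nonneg _)).trans_eq ?_
  have h2 : (1 / 2 + 1 / (2 * √2) : ℝ) = (1 + 1 / √2) / 2 := by
    field_simp
  -- The weight is `2 ^ (-3n)`: one factor `2 ^ (-n)` cancels the sum over `r`, one the sum over
  -- encoded strings, and the last, for the choice of basis, turns `1 + 1/√2` into its half.
  rw [h2, div_pow, pairWeight]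
  simp only [Fintype.card_pi, Fintype.card_bool, Finset.prod_const, Finset.card_univ,
    Fintype.card_fin, Fintype.card_sum]
  push_cast
  rw [pow_add]
  field_simp

end Reusable

/-- The bound for cloning adversaries in closed form. -/
theorem exists_negligible_cloningSuccess_le (n keyLen ctLen : ℕ → ℕ)
    (E : PrivKeyEnc (fun l => Fin (keyLen l)) (fun l => Fin (n l) ⊕ Fin (n l))
      (fun l => Fin (ctLen l)))
    (hE : HasFakeKeyProperty E)
    (A : CloningAdversary (fun l => Fin (keyLen l)) (fun l => Fin (n l))
      (fun l => Fin (ctLen l) ⊕ Fin (n l))) (hA : A.IsQPT) :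
    ∃ ε : ℕ → ℝ, Negligible ε ∧ ∀ l,
      cloningSuccess (reusableScheme E (conjugateEncryption n)) A l ≤
        (1 / 2 + 1 / (2 * √2)) ^ n l + ε l := by
  obtain ⟨fakeGen, hfake⟩ := hE
  choose D hsize hD using fun l (μ : Bits (Fin (n l) ⊕ Fin (n l))) (m : Bits (Fin (n l))) =>
    exists_distinguisher (A.alice l) (A.bob l) (A.charlie l) (fun i => μ (.inl i))
      (fun i => xor (m i) (μ (.inr i))) m
  let gap : ∀ l, Bits (Fin (n l) ⊕ Fin (n l)) × Bits (Fin (n l)) → ℝ := fun l p =>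
    |acceptProb (D l p.1 p.2) (E.realDist l p.1) -
      acceptProb (D l p.1 p.2) (E.fakeDist fakeGen l p.1)|
  -- The fake-key property yields one negligible function per family of distinguishers. Hardwiring
  -- the pair with the largest gap for each `l` makes a single family control all pairs.
  choose worst hworst using fun l => Finite.exists_max (gap l)
  have hpoly : PolyBounded fun l => (D l (worst l).1 (worst l).2).size := by
    obtain ⟨h1, h2, h3⟩ := hA
    exact ((((h1.const_mul 9).add (h2.const_mul 2)).add h3).add (PolyBounded.const 2)).mono
      fun l => hsize l _ _
  obtain ⟨ε, hε, hgap⟩ := hfake (fun l => D l (worst l).1 (worst l).2) hpoly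
  refine ⟨ε, hε, fun l => ?_⟩
  have hle : ∀ μ m, acceptProb (D l μ m) (E.realDist l μ) ≤
      acceptProb (D l μ m) (E.fakeDist fakeGen l μ) + ε l := by
    intro μ m
    have h1 : gap l (μ, m) ≤ ε l := (hworst l (μ, m)).trans (hgap l (worst l).1)
    have h2 := (le_abs_self _).trans h1
    linarith
  rw [cloningSuccess_eq_sum_acceptProb E A l (D l) (hD l)]
  calc _ ≤ ∑ μ, ∑ m, pairWeight (n l) * (acceptProb (D l μ m) (E.fakeDist fakeGen l μ) + ε l) :=
        Finset.sum_le_sum fun μ _ => Finset.sum_le_sum fun m _ =>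
          mul_le_mul_of_nonneg_left (hle μ m) (pairWeight_nonneg _)
    _ = ∑ μ, ∑ m, pairWeight (n l) * acceptProb (D l μ m) (E.fakeDist fakeGen l μ) + ε l := by
        simp_rw [mul_add, Finset.sum_add_distrib, ← Finset.sum_mul]
        rw [sum_pairWeight, one_mul]
    _ ≤ _ := by
        gcongr
        exact sum_acceptProb_fakeDist_le E A l (D l) (hD l) fakeGen

lemma two_rpow_neg_add_mul_logb (n : ℕ) :
    (2 : ℝ) ^ (-(n : ℝ) + n * Real.logb 2 (1 + 1 / √2)) = (1 / 2 + 1 / (2 * √2)) ^ n := by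
  have h : (0 : ℝ) < 1 + 1 / √2 := by positivity
  rw [Real.rpow_add two_pos, Real.rpow_neg two_pos.le, Real.rpow_natCast, mul_comm (n : ℝ),
    Real.rpow_mul two_pos.le, Real.rpow_logb two_pos (by norm_num) h, Real.rpow_natCast,
    ← inv_pow, ← mul_pow]
  congr 1
  field_simp

end UncloneableEncryption

end

open UncloneableEncryption in
theorem mainTheorem3 (n keyLen ctLen : ℕ → ℕ)
    (E : PrivKeyEnc (fun l => Fin (keyLen l)) (fun l => Fin (n l) ⊕ Fin (n l))
      (fun l => Fin (ctLen l)))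
    (hE : HasFakeKeyProperty E) :
    IsUncloneableSecure (reusableScheme E (conjugateEncryption n))
        (fun l => (n l : ℝ) * Real.logb 2 (1 + 1 / Real.sqrt 2)) ∧
      ∀ A : CloningAdversary (fun l => Fin (keyLen l)) (fun l => Fin (n l))
          (fun l => Fin (ctLen l) ⊕ Fin (n l)), A.IsQPT →
        ∃ ε : ℕ → ℝ, Negligible ε ∧ ∀ l,
          cloningSuccess (reusableScheme E (conjugateEncryption n)) A l ≤
            (1 / 2 + 1 / (2 * Real.sqrt 2)) ^ n l + ε l := by
  have h := exists_negligible_cloningSuccess_le n keyLen ctLen E hE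
  refine ⟨fun A hA => ?_, h⟩
  obtain ⟨ε, hε, hle⟩ := h A hA
  refine ⟨ε, hε, fun l => ?_⟩
  rw [Fintype.card_fin, two_rpow_neg_add_mul_logb]
  exact hle l
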